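/- All groups are finite. A group $X$ is called an $\mathscr{A}_\pi$-group if any two abelian subgroups of $X$ of equal prime power order are conjugate in $X$. Let $C_u$ denote the cyclic group of order $u$, $E_{p^n}$ the elementary abelian group of order $p^n$, $Q$ the quaternion group of order $8$, and $O_{2'}(X)$ the largest normal subgroup of odd order of $X$. Let $X$ be a solvable $\mathscr{A}_\pi$-group. If $p$ is a prime dividing $|X|$ and $S_p$ is a Sylow $p$-subgroup of $X$, then $S_p$ is isomorphic to one of the following groups: $C_{p^a}$ with $a\ge 1$; $E_{p^2}$ or $E_{p^3}$ with $p\ne 2$; $E_4$, $E_8$, $E_{32}$ or $Q$ (with $p=2$). Furthermore, $X/O_{2'}(X)$ is isomorphic to one of the following groups: $C_{2^a}$ with $a\ge 0$, $E_4\rtimes C_3$, $E_8\rtimes(C_7\rtimes C_3)$, $E_8\rtimes C_7$, $E_{32}\rtimes(C_{31}\rtimes C_5)$, $Q\rtimes C_3$, where in each semidirect product $N\rtimes H$ occurring here (including the inner ones $C_7\rtimes C_3$ and $C_{31}\rtimes C_5$) the group $H$ acts faithfully on $N$; this determines each of these groups up to isomorphism. -/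

import Mathlib

/-- `X` is an `A_π`-group: any two abelian subgroups of `X` of equal prime power order are
conjugate in `X`. -/
def IsApiGroup (X : Type*) [Group X] : Prop :=
  ∀ (p n : ℕ), p.Prime → ∀ A B : Subgroup X, IsMulCommutative A → IsMulCommutative B →
    Nat.card A = p ^ n → Nat.card B = p ^ n →
    ∃ g : X, A.map (MulAut.conj g).toMonoidHom = B

/-- The cyclic group `C_u` of order `u` (for `u ≥ 1`), written multiplicatively. -/
abbrev CyclicGrp (u : ℕ) : Type := Multiplicative (ZMod u)

/-- The elementary abelian group `E_{p^n}` of order `p ^ n`, written multiplicatively. -/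
abbrev ElemAbGrp (p n : ℕ) : Type := Multiplicative (Fin n → ZMod p)

/-- The quaternion group `Q` of order `8`. -/
abbrev QuatGrp : Type := QuaternionGroup 2

/-- `O_{2'}(X)`: the subgroup generated by all normal subgroups of odd order; for finite `X` it is
the largest normal subgroup of odd order. -/
def oddCore (X : Type*) [Group X] : Subgroup X :=
  sSup {N : Subgroup X | N.Normal ∧ Odd (Nat.card N)}

instance oddCore_normal (X : Type*) [Group X] : (oddCore X).Normal :=
  Subgroup.sSup_normal _ fun _ hN => hN.1

/-- `G` is isomorphic to a semidirect product `N ⋊ H` in which `H` acts faithfully on `N`. -/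
def IsFaithfulSemidirect (G N H : Type*) [Group G] [Group N] [Group H] : Prop :=
  ∃ φ : H →* MulAut N, Function.Injective φ ∧ Nonempty (G ≃* N ⋊[φ] H)

/-- `G` is isomorphic to a semidirect product `N ⋊ (K ⋊ L)` in which `L` acts faithfully on `K`
and `K ⋊ L` acts faithfully on `N`. -/
def IsFaithfulDoubleSemidirect (G N K L : Type*) [Group G] [Group N] [Group K] [Group L] : Prop :=
  ∃ ψ : L →* MulAut K, Function.Injective ψ ∧ IsFaithfulSemidirect G N (K ⋊[ψ] L)

/-! Fix a prime `p`. Dividing out the largest normal subgroup of order prime to `p` changes neither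
the Sylow `p`-subgroups nor the conjugacy hypothesis at `p` (`IsApiAt.quotient`). In the quotient
`G`, solvability makes the largest normal `p`-subgroup `T` contain its centralizer. The hypothesis
is then used mostly in this form: a normal subgroup containing one element of order `p ^ k` contains
all of them (`IsApiAt.mem_normal_of_orderOf_eq`). Hence a suitable normal subgroup built inside `T`
swallows every `p`-element and is the Sylow subgroup.

If `G` has no element of order `p ^ 2`, the elements of order dividing `p` in the centre of `T` form
that subgroup, and it is elementary abelian. Otherwise there is a normal subgroup of order `p`. A
maximal normal cyclic `p`-subgroup `A` above it is either the whole Sylow subgroup, or a commutator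
calculation in its centralizer forces `p = 2`, `|A| = 2` and a quaternion Sylow subgroup
(`IsApiAt.exists_cyclic_or_quaternion`).

In the elementary case of rank `n`, `G` acts on `S = F_p ^ n` transitively on subspaces of each
dimension. Let `q = p` and let `H` be the image with the scalars adjoined. Every subgroup normalised
by `H` is scalar or irreducible. If there is a nonscalar abelian one, `H` acts semilinearly on a
one-dimensional space over a field extension and `|H|` divides `n (q ^ n - 1)`. If not, there is a
subgroup `B` with scalar commutators and scalar centre; over `F_2` this is absurd at once, and for
`n ≥ 4` a double count of vectors and planes excludes it
(`not_isPlaneTransitive_of_symplecticType`). Comparing the order bound with the number of planes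
leaves only `q = 2`, `n = 5` among ranks at least 4.

For `p = 2` the same divisibilities determine `|G : S|`: it is 3, 7 or 21, or 155 for `n = 2, 3, 5`.
A cyclic `S` is all of `G`, and a quaternion `S` has index 3. Schur–Zassenhaus supplies a
complement, faithful because `S` is self-centralizing. Complements of order 21 and 155 are
nonabelian, since a central element of order 3 or 5 would fix an involution, hence by transitivity
all of `S`. -/

open Module

/-! ### Linear groups transitive on vectors and planes: normalised subgroups -/

section LinearGroups

variable {F V : Type*} [Field F] [AddCommGroup V] [Module F V]

/-- The linear automorphism `g` is multiplication by a scalar. -/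
def IsScalarAut (g : V ≃ₗ[F] V) : Prop := ∃ c : F, ∀ v, g v = c • v

/-- A linear group containing all scalars which is transitive on the nonzero vectors and on the
two-dimensional subspaces. -/
structure IsPlaneTransitive (H : Subgroup (V ≃ₗ[F] V)) : Prop where
  vec : ∀ v w : V, v ≠ 0 → w ≠ 0 → ∃ h ∈ H, h v = w
  plane : ∀ U W : Submodule F V, finrank F U = 2 → finrank F W = 2 →
    ∃ h ∈ H, U.map (h : V →ₗ[F] V) = W
  scalar : ∀ g : V ≃ₗ[F] V, IsScalarAut g → g ∈ H

/-- `N` is normalised by `H`. -/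
def NormalizedBy (N H : Subgroup (V ≃ₗ[F] V)) : Prop := ∀ h ∈ H, ∀ n ∈ N, h * n * h⁻¹ ∈ N

/-- The subspace `W` is invariant under `N`. -/
def IsInvariantUnder (N : Subgroup (V ≃ₗ[F] V)) (W : Submodule F V) : Prop :=
  ∀ g ∈ N, ∀ w ∈ W, g w ∈ W

theorem isScalarAut_of_forall_eigenvector {g : V ≃ₗ[F] V}
    (h : ∀ v, ∃ c : F, g v = c • v) : IsScalarAut g := by
  obtain ⟨a, ha⟩ := LinearMap.exists_eq_smul_id_of_forall_notLinearIndependent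
    (f := (g : V →ₗ[F] V)) (fun v hv => by
      obtain ⟨c, hc⟩ := h v
      rw [LinearIndependent.pair_iff] at hv
      have := hv c (-1) (by simp [hc])
      simp at this)
  exact ⟨a, fun v => by simpa using LinearMap.congr_fun ha v⟩

theorem linearIndependent_pair_of_notMem_span {u v : V} (hu : u ≠ 0) (hv : ∀ c : F, v ≠ c • u) :
    LinearIndependent F ![u, v] := by
  rw [LinearIndependent.pair_iff' hu]
  exact fun a h => hv a h.symm

theorem finrank_span_pair_eq_two {u v : V} (h : LinearIndependent F ![u, v]) :
    finrank F (Submodule.span F {u, v}) = 2 := by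
  have := finrank_span_eq_card h
  rwa [Matrix.range_cons_cons_empty, Fintype.card_fin] at this

theorem exists_plane_le {W : Submodule F V} [Finite V] (hW : 2 ≤ finrank F W) :
    ∃ U ≤ W, finrank F U = 2 := by
  obtain ⟨x, hx⟩ : ∃ x : W, x ≠ 0 := by
    have : Nontrivial W := Module.nontrivial_of_finrank_pos (R := F) (by omega)
    exact exists_ne 0
  obtain ⟨y, hy⟩ := exists_linearIndependent_pair_of_one_lt_finrank (R := F) (by omega) hx
  have hli : LinearIndependent F ![(x : V), (y : V)] := by
    have h1 := hy.map' W.subtype (by simp)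
    rwa [show W.subtype ∘ ![x, y] = ![(x : V), (y : V)] by ext i; fin_cases i <;> rfl] at h1
  refine ⟨_, ?_, finrank_span_pair_eq_two hli⟩
  rw [Submodule.span_le]
  rintro z (rfl | rfl)
  · exact x.2
  · exact y.2

theorem IsInvariantUnder.map_of_normalizedBy {N H : Subgroup (V ≃ₗ[F] V)} (hN : NormalizedBy N H)
    {W : Submodule F V} (hW : IsInvariantUnder N W) {h : V ≃ₗ[F] V} (hh : h ∈ H) :
    IsInvariantUnder N (W.map (h : V →ₗ[F] V)) := by
  rintro g hg _ ⟨w, hw, rfl⟩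
  refine ⟨(h⁻¹ * g * h) w, hW _ ?_ w hw, ?_⟩
  · simpa using hN h⁻¹ (H.inv_mem hh) g hg
  · simp [LinearEquiv.mul_apply]

/-- Translates under `H` of a minimal nonzero invariant subspace `W` are again invariant. If `W` is
a line, its translates cover `V`, so every vector is an eigenvector. If `W` contains a plane, every
plane lies in a translate of `W`; a translate meeting `W` nontrivially equals `W`, so a plane
through `W` and a vector outside it cannot exist. -/
theorem IsPlaneTransitive.scalar_or_irreducible [Finite V] {H N : Subgroup (V ≃ₗ[F] V)}
    (hH : IsPlaneTransitive H) (hN : NormalizedBy N H) [Nontrivial V] :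
    (∀ g ∈ N, IsScalarAut g) ∨ ∀ W, IsInvariantUnder N W → W = ⊥ ∨ W = ⊤ := by
  obtain ⟨W, ⟨hW0, hWN⟩, hmin⟩ : ∃ W : Submodule F V, (W ≠ ⊥ ∧ IsInvariantUnder N W) ∧
      ∀ W' : Submodule F V, (W' ≠ ⊥ ∧ IsInvariantUnder N W') → W' ≤ W → W' = W := by
    obtain ⟨W, hW⟩ := (Set.toFinite {W : Submodule F V | W ≠ ⊥ ∧ IsInvariantUnder N W}).exists_minimal
      ⟨⊤, top_ne_bot, fun _ _ _ _ => trivial⟩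
    exact ⟨W, hW.1, fun W' h' hle => le_antisymm hle (hW.2 h' hle)⟩
  obtain ⟨w, hwW, hw0⟩ := W.ne_bot_iff.1 hW0
  by_cases h1 : finrank F W ≤ 1
  · left
    intro g hg
    apply isScalarAut_of_forall_eigenvector
    intro v
    by_cases hv : v = 0
    · exact ⟨0, by simp [hv]⟩
    obtain ⟨h, hh, hwv⟩ := hH.vec w v hw0 hv
    have hinv := hWN.map_of_normalizedBy hN hh g hg v ⟨w, hwW, hwv⟩
    have hle : finrank F (W.map (h : V →ₗ[F] V)) ≤ 1 := (Submodule.finrank_map_le _ _).trans h1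
    obtain ⟨⟨x, hx⟩, hx'⟩ := finrank_le_one_iff.1 hle
    obtain ⟨a, ha⟩ := hx' ⟨v, w, hwW, hwv⟩
    obtain ⟨b, hb⟩ := hx' ⟨_, hinv⟩
    simp only [Subtype.ext_iff, Submodule.coe_smul] at ha hb
    have ha0 : a ≠ 0 := by rintro rfl; simp at ha; exact hv ha.symm
    refine ⟨b * a⁻¹, ?_⟩
    rw [← hb, ← ha, mul_smul, inv_smul_smul₀ ha0]
  · right
    push Not at h1
    have hWtop : W = ⊤ := by
      rw [Submodule.eq_top_iff']
      by_contra! hcon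
      obtain ⟨v, hv⟩ := hcon
      obtain ⟨U, hUW, hU⟩ := exists_plane_le (F := F) h1
      have hli : LinearIndependent F ![w, v] :=
        linearIndependent_pair_of_notMem_span hw0 (fun c hc => hv (hc ▸ W.smul_mem c hwW))
      obtain ⟨h, hh, hUh⟩ := hH.plane U _ hU (finrank_span_pair_eq_two hli)
      set M := W.map (h : V →ₗ[F] V) with hM
      have hle : Submodule.span F {w, v} ≤ M := hUh ▸ Submodule.map_mono hUW
      have hMN : IsInvariantUnder N M := hWN.map_of_normalizedBy hN hh
      have hMW : M ⊓ W = W := by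
        refine hmin (M ⊓ W) ⟨?_, fun g hg x hx => ?_⟩ inf_le_right
        · rw [Submodule.ne_bot_iff]
          exact ⟨w, ⟨hle (Submodule.subset_span (by simp)), hwW⟩, hw0⟩
        · exact Submodule.mem_inf.2 ⟨hMN g hg x hx.1, hWN g hg x hx.2⟩
      have hWM : W ≤ M := hMW ▸ inf_le_left
      have heq : W = M := by
        apply Submodule.eq_of_le_of_finrank_le hWM
        exact Submodule.finrank_map_le _ _
      exact hv (heq ▸ hle (Submodule.subset_span (by simp)))
    intro W' hW'
    by_cases h0 : W' = ⊥
    · exact Or.inl h0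
    · right
      rw [← hWtop]
      exact hmin W' ⟨h0, hW'⟩ (hWtop ▸ le_top)

end LinearGroups

/-! ### Divisibility from free actions -/

section FreeActions

theorem card_dvd_card_of_free_action {G α : Type*} [Group G] [MulAction G α]
    (h : ∀ (g : G) (a : α), g • a = a → g = 1) : Nat.card G ∣ Nat.card α := by
  have e := MulAction.selfEquivOrbitsQuotientProd (G := G) (X := α) (fun b => by
    rw [eq_bot_iff]
    intro g hg
    exact h g b hg)
  rw [Nat.card_congr e, Nat.card_prod]
  exact dvd_mul_left _ _

end FreeActions

/-! ### Counting planes, vectors and scalars -/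

section Counting

variable {F V : Type*} [Field F] [Finite F] [AddCommGroup V] [Module F V] [Finite V]

variable (F V) in
/-- The two-dimensional subspaces of `V`. -/
abbrev Plane : Type _ := {U : Submodule F V // finrank F U = 2}

theorem card_linearIndependent_pairs (h : 2 ≤ finrank F V) :
    Nat.card {s : Fin 2 → V // LinearIndependent F s} =
      (Nat.card F ^ finrank F V - 1) * (Nat.card F ^ finrank F V - Nat.card F) := by
  have := Fintype.ofFinite F
  rw [card_linearIndependent h, Fin.prod_univ_two, Nat.card_eq_fintype_card]
  simp

/-- The plane spanned by a linearly independent pair. -/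
def spanPlane (s : {s : Fin 2 → V // LinearIndependent F s}) : Plane F V :=
  ⟨Submodule.span F (Set.range s.1), by simpa using finrank_span_eq_card s.2⟩

/-- The linearly independent pairs spanning `U` are the linearly independent pairs of `U`. -/
def spanPlaneFiberEquiv (U : Plane F V) :
    {s : {s : Fin 2 → V // LinearIndependent F s} // spanPlane s = U} ≃
      {s : Fin 2 → U.1 // LinearIndependent F s} where
  toFun s := ⟨fun i => ⟨s.1.1 i,
      (congrArg Subtype.val s.2).le (Submodule.subset_span (Set.mem_range_self i))⟩,
    LinearIndependent.of_comp U.1.subtype s.1.2⟩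
  invFun t := ⟨⟨fun i => (t.1 i : V), t.2.map' U.1.subtype (by simp)⟩, by
    apply Subtype.ext
    apply Submodule.eq_of_le_of_finrank_eq
    · change Submodule.span F _ ≤ _
      rw [Submodule.span_le]
      rintro _ ⟨i, rfl⟩
      exact (t.1 i).2
    · rw [U.2]; exact (spanPlane _).2⟩
  left_inv s := rfl
  right_inv t := rfl

/-- Ordered independent pairs of `V` are fibred over the planes they span, and each fibre is the set
of such pairs in a two-dimensional space. -/
theorem card_plane_mul (h : 2 ≤ finrank F V) :
    Nat.card (Plane F V) * ((Nat.card F ^ 2 - 1) * (Nat.card F ^ 2 - Nat.card F)) =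
      (Nat.card F ^ finrank F V - 1) * (Nat.card F ^ finrank F V - Nat.card F) := by
  rw [← card_linearIndependent_pairs h,
    ← Nat.card_congr (Equiv.sigmaFiberEquiv (spanPlane (F := F) (V := V)))]
  have := Fintype.ofFinite (Plane F V)
  rw [Nat.card_sigma, Finset.sum_congr rfl (fun U _ => show _ =
      (Nat.card F ^ 2 - 1) * (Nat.card F ^ 2 - Nat.card F) by
    rw [Nat.card_congr (spanPlaneFiberEquiv U), card_linearIndependent_pairs U.2.ge, U.2])]
  simp

theorem card_eq_card_field_pow : Nat.card V = Nat.card F ^ finrank F V := by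
  have := Fintype.ofFinite F
  have := Fintype.ofFinite V
  simpa using Module.card_eq_pow_finrank (K := F) (V := V)

theorem card_nonzero : Nat.card {v : V // v ≠ 0} = Nat.card F ^ finrank F V - 1 := by
  classical
  have := Fintype.ofFinite V
  rw [← card_eq_card_field_pow (F := F) (V := V), Nat.card_eq_fintype_card, Nat.card_eq_fintype_card,
    Fintype.card_subtype_compl, Fintype.card_subtype_eq]

variable (F V) in
/-- The group of scalar automorphisms. -/
def scalarSubgroup : Subgroup (V ≃ₗ[F] V) := (DistribMulAction.toModuleAut F V : Fˣ →* _).range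

omit [Finite F] [Finite V] in
theorem mem_scalarSubgroup [Nontrivial V] {g : V ≃ₗ[F] V} :
    g ∈ scalarSubgroup F V ↔ IsScalarAut g := by
  constructor
  · rintro ⟨c, rfl⟩
    exact ⟨c, fun v => rfl⟩
  · rintro ⟨c, hc⟩
    obtain ⟨v, hv⟩ := exists_ne (0 : V)
    have hc0 : c ≠ 0 := by
      rintro rfl
      apply hv
      apply g.injective
      simp [hc]
    refine ⟨Units.mk0 c hc0, ?_⟩
    ext w
    exact (hc w).symm

omit [Finite V] in
theorem card_scalarSubgroup [Nontrivial V] : Nat.card (scalarSubgroup F V) = Nat.card F - 1 := by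
  have := Fintype.ofFinite F
  rw [← Nat.card_units]
  refine (Nat.card_congr (MonoidHom.ofInjective (f := (DistribMulAction.toModuleAut F V : Fˣ →* _)) ?_).toEquiv).symm
  intro a b hab
  obtain ⟨v, hv⟩ := exists_ne (0 : V)
  have : (a : F) • v = (b : F) • v := LinearEquiv.congr_fun hab v
  exact Units.ext (smul_left_injective F hv this)

open Pointwise in
-- The planes form one orbit, and the stabilizer of a plane contains all scalars, which contribute
-- the factor `q - 1`.
theorem IsPlaneTransitive.card_plane_mul_dvd [Nontrivial V] {H : Subgroup (V ≃ₗ[F] V)}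
    (hH : IsPlaneTransitive H) (h : 2 ≤ finrank F V) :
    (Nat.card F - 1) * Nat.card (Plane F V) ∣ Nat.card H := by
  obtain ⟨U, -, hU⟩ := exists_plane_le (F := F) (V := V) (W := ⊤) (by simpa using h)
  have h1 : MulAction.orbit H U = {W : Submodule F V | finrank F W = 2} := by
    ext W
    constructor
    · rintro ⟨g, rfl⟩
      rw [Set.mem_ofPred_eq, ← hU]
      exact LinearEquiv.finrank_map_eq (g : V ≃ₗ[F] V) U
    · intro hW
      obtain ⟨g, hg, hgU⟩ := hH.plane U W hU hW
      exact ⟨⟨g, hg⟩, hgU⟩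
  have h2 : Nat.card (MulAction.orbit H U) * Nat.card (MulAction.stabilizer H U) = Nat.card H := by
    rw [← Nat.card_prod]
    exact Nat.card_congr (MulAction.orbitProdStabilizerEquivGroup H U)
  rw [← h2, h1, mul_comm]
  refine mul_dvd_mul dvd_rfl ?_
  have h3 : scalarSubgroup F V ≤ H := fun g hg => hH.scalar g (mem_scalarSubgroup.1 hg)
  have h4 : (scalarSubgroup F V).subgroupOf H ≤ MulAction.stabilizer H U := by
    rintro ⟨g, hg⟩ hgs
    obtain ⟨c, hc⟩ := mem_scalarSubgroup.1 (Subgroup.mem_subgroupOf.1 hgs)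
    change U.map (g : V →ₗ[F] V) = U
    apply Submodule.eq_of_le_of_finrank_eq
    · rintro _ ⟨u, hu, rfl⟩
      have : g u = c • u := hc u
      simp only [LinearEquiv.coe_coe, this]
      exact U.smul_mem c hu
    · exact LinearEquiv.finrank_map_eq g U
  rw [← card_scalarSubgroup (V := V), ← Nat.card_congr (Subgroup.subgroupOfEquivOfLe h3).toEquiv]
  exact Subgroup.card_dvd_of_le h4

theorem IsPlaneTransitive.card_nonzero_dvd [Nontrivial V] {H : Subgroup (V ≃ₗ[F] V)}
    (hH : IsPlaneTransitive H) : Nat.card F ^ finrank F V - 1 ∣ Nat.card H := by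
  obtain ⟨v, hv⟩ := exists_ne (0 : V)
  have h1 : MulAction.orbit H v = {w : V | w ≠ 0} := by
    ext w
    constructor
    · rintro ⟨g, rfl⟩
      exact fun h => hv ((g : V ≃ₗ[F] V).map_eq_zero_iff.1 h)
    · intro hw
      obtain ⟨g, hg, hgw⟩ := hH.vec v w hv hw
      exact ⟨⟨g, hg⟩, hgw⟩
  have h2 : Nat.card (MulAction.orbit H v) * Nat.card (MulAction.stabilizer H v) = Nat.card H := by
    rw [← Nat.card_prod]
    exact Nat.card_congr (MulAction.orbitProdStabilizerEquivGroup H v)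
  rw [← h2, h1, ← card_nonzero (F := F) (V := V)]
  exact dvd_mul_right _ _

end Counting

/-! ### An irreducible abelian normalised subgroup: the semilinear case -/

section FieldCase

universe w

variable {F : Type*} {V : Type w} [Field F] [Finite F] [AddCommGroup V] [Module F V] [Finite V] [Nontrivial V]

open scoped IsMulCommutative in
-- Schur's lemma: the kernel of an element of the commutative algebra generated by `A` is
-- `A`-invariant, so nonzero elements are injective. The algebra is a finite domain, hence a field.
theorem exists_field_of_irreducible_abelian {A : Subgroup (V ≃ₗ[F] V)}
    (hcomm : ∀ a ∈ A, ∀ b ∈ A, a * b = b * a)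
    (hirr : ∀ W, IsInvariantUnder A W → W = ⊥ ∨ W = ⊤) :
    ∃ (K : Type w) (_ : Field K) (_ : Algebra F K) (ι : K →ₐ[F] Module.End F V),
      ι.range = Algebra.adjoin F ((fun a : V ≃ₗ[F] V => (a : Module.End F V)) '' A) := by
  set S : Set (Module.End F V) := (fun a : V ≃ₗ[F] V => (a : Module.End F V)) '' A with hS
  have hSc : ∀ a ∈ S, ∀ b ∈ S, a * b = b * a := by
    rintro _ ⟨a, ha, rfl⟩ _ ⟨b, hb, rfl⟩
    ext v
    exact LinearEquiv.congr_fun (hcomm a ha b hb) v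
  have := Algebra.isMulCommutative_adjoin F hSc
  have : Finite (Module.End F V) := Finite.of_injective _ DFunLike.coe_injective
  have hinj : ∀ r : Algebra.adjoin F S, r ≠ 0 → ∀ v, r.1 v = 0 → v = 0 := by
    intro r hr v hv
    rcases hirr (LinearMap.ker r.1) (fun g hg w hw => by
      have hcom : r * ⟨(g : Module.End F V), Algebra.subset_adjoin ⟨g, hg, rfl⟩⟩ =
        ⟨(g : Module.End F V), Algebra.subset_adjoin ⟨g, hg, rfl⟩⟩ * r := mul_comm _ _
      have := LinearMap.congr_fun (congrArg Subtype.val hcom) w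
      have h2 : r.1 (g w) = g (r.1 w) := this
      rw [LinearMap.mem_ker] at hw ⊢
      rw [h2, hw, map_zero]) with h | h
    · have : v ∈ LinearMap.ker r.1 := hv
      rwa [h] at this
    · exfalso
      apply hr
      apply Subtype.ext
      exact LinearMap.ker_eq_top.1 h
  have : NoZeroDivisors (Algebra.adjoin F S) := ⟨by
    intro a b hab
    by_contra! hcon
    apply hcon.2
    apply Subtype.ext
    ext v
    apply hinj a hcon.1
    exact LinearMap.congr_fun (congrArg Subtype.val hab) v⟩
  have : Nontrivial (Algebra.adjoin F S) := inferInstance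
  have : IsDomain (Algebra.adjoin F S) := NoZeroDivisors.to_isDomain _
  let : Field (Algebra.adjoin F S) := (Finite.isField_of_domain (Algebra.adjoin F S)).toField
  exact ⟨Algebra.adjoin F S, inferInstance, inferInstance, (Algebra.adjoin F S).val,
    Subalgebra.range_val _⟩

/-- `V` is one-dimensional over the field `K` generated by `A`, so `[K : F] = n`. Conjugation maps
`H` to the Galois group of `K` over `F`, whose order is `n`. The kernel acts `K`-linearly, hence
freely on the nonzero vectors. -/
theorem card_dvd_of_irreducible_abelian {H A : Subgroup (V ≃ₗ[F] V)} (hAH : NormalizedBy A H)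
    (hcomm : ∀ a ∈ A, ∀ b ∈ A, a * b = b * a)
    (hirr : ∀ W, IsInvariantUnder A W → W = ⊥ ∨ W = ⊤) :
    Nat.card H ∣ finrank F V * (Nat.card F ^ finrank F V - 1) := by
  obtain ⟨K, _, _, ι, hι⟩ := exists_field_of_irreducible_abelian hcomm hirr
  have hιinj : Function.Injective ι := ι.toRingHom.injective
  have hfree : ∀ w : V, w ≠ 0 → Function.Bijective (fun k : K => ι k w) := by
    intro w hw
    let f : K →ₗ[F] V := (LinearMap.applyₗ w : Module.End F V →ₗ[F] V) ∘ₗ ι.toLinearMap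
    have hf : ∀ k, f k = ι k w := fun k => rfl
    constructor
    · change Function.Injective f
      rw [injective_iff_map_eq_zero]
      intro k hk
      by_contra hk0
      apply hw
      have : ι (k⁻¹ * k) w = 0 := by rw [map_mul, Module.End.mul_apply, ← hf, hk, map_zero]
      simpa [inv_mul_cancel₀ hk0] using this
    · change Function.Surjective f
      rw [← LinearMap.range_eq_top]
      refine (hirr _ ?_).resolve_left ?_
      · rintro g hg _ ⟨k, rfl⟩
        obtain ⟨k', hk'⟩ : (g : Module.End F V) ∈ ι.range := by
          rw [hι]; exact Algebra.subset_adjoin ⟨g, hg, rfl⟩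
        refine ⟨k' * k, ?_⟩
        have hk'' : ι k' = (g : Module.End F V) := hk'
        rw [hf, hf, map_mul, Module.End.mul_apply, hk'']
        rfl
      · intro h
        apply hw
        have : f 1 ∈ LinearMap.range f := ⟨1, rfl⟩
        rw [h] at this
        simpa [hf] using this
  obtain ⟨w, hw⟩ := exists_ne (0 : V)
  have hfin : finrank F K = finrank F V := by
    let f : K →ₗ[F] V := (LinearMap.applyₗ w : Module.End F V →ₗ[F] V) ∘ₗ ι.toLinearMap
    exact LinearEquiv.finrank_eq (LinearEquiv.ofBijective f (hfree w hw))
  have : Finite K := Finite.of_injective _ (hfree w hw).1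
  -- Conjugation by `h` preserves the algebra because it preserves its generators `A`; the choice of
  -- `k'` is the field automorphism induced by `h`.
  have hconj : ∀ h : H, ∀ k : K, ∃ k' : K, ∀ v, ι k' (h.1 v) = h.1 (ι k v) := by
    intro h k
    have hk : ι k ∈ Algebra.adjoin F ((fun a : V ≃ₗ[F] V => (a : Module.End F V)) '' A) := by
      rw [← hι]; exact ⟨k, rfl⟩
    suffices ∀ r ∈ Algebra.adjoin F ((fun a : V ≃ₗ[F] V => (a : Module.End F V)) '' A),
        ∃ k' : K, ∀ v, ι k' (h.1 v) = h.1 (r v) from this _ hk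
    intro r hr
    induction hr using Algebra.adjoin_induction with
    | mem x hx =>
      obtain ⟨a, ha, rfl⟩ := hx
      obtain ⟨k', hk'⟩ : ((h.1 * a * h.1⁻¹ : V ≃ₗ[F] V) : Module.End F V) ∈ ι.range := by
        rw [hι]; exact Algebra.subset_adjoin ⟨_, hAH h.1 h.2 a ha, rfl⟩
      refine ⟨k', fun v => ?_⟩
      have hk'' : ι k' = ((h.1 * a * h.1⁻¹ : V ≃ₗ[F] V) : Module.End F V) := hk'
      rw [hk'']
      change h.1 (a (h.1⁻¹ (h.1 v))) = h.1 (a v)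
      have : (h.1⁻¹ * h.1) v = v := by rw [inv_mul_cancel]; rfl
      rw [LinearEquiv.mul_apply] at this
      rw [this]
    | algebraMap c => exact ⟨algebraMap F K c, fun v => by simp⟩
    | add x y _ _ hx hy =>
      obtain ⟨k, hk⟩ := hx
      obtain ⟨l, hl⟩ := hy
      exact ⟨k + l, fun v => by simp [hk, hl]⟩
    | mul x y _ _ hx hy =>
      obtain ⟨k, hk⟩ := hx
      obtain ⟨l, hl⟩ := hy
      exact ⟨k * l, fun v => by simp [hk, hl]⟩
  choose σ hσ using hconj
  have hext : ∀ (h : H) (k l : K), (∀ v, ι k (h.1 v) = ι l (h.1 v)) → k = l := by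
    intro h k l hkl
    apply hιinj
    ext v
    obtain ⟨u, rfl⟩ := h.1.surjective v
    exact hkl u
  let τ : H →* (K →ₐ[F] K) :=
    { toFun := fun h =>
        { toFun := σ h
          map_one' := hext h _ _ fun v => by simp [hσ]
          map_zero' := hext h _ _ fun v => by simp [hσ]
          map_add' := fun x y => hext h _ _ fun v => by simp [hσ]
          map_mul' := fun x y => hext h _ _ fun v => by simp [hσ]
          commutes' := fun c => hext h _ _ fun v => by simp [hσ] }
      map_one' := by
        ext k
        exact hext 1 _ _ fun v => hσ 1 k v
      map_mul' := fun g h => by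
        ext k
        refine hext (g * h) _ _ fun v => (hσ (g * h) k v).trans ?_
        change g.1 (h.1 (ι k v)) = ι (σ g (σ h k)) (g.1 (h.1 v))
        rw [hσ, hσ] }
  let ρ : H →* (K ≃ₐ[F] K) := (AlgEquiv.algHomUnitsEquiv F K).toMonoidHom.comp τ.toHomUnits
  have hρ : ∀ (h : H) (k : K), ρ h k = σ h k := fun h k => rfl
  have hker : Nat.card ρ.ker ∣ Nat.card F ^ finrank F V - 1 := by
    rw [← card_nonzero (F := F) (V := V)]
    let act : MulAction ρ.ker {v : V // v ≠ 0} :=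
      { smul := fun h v => ⟨h.1.1 v.1, fun h0 => v.2 (h.1.1.map_eq_zero_iff.1 h0)⟩
        one_smul := fun v => rfl
        mul_smul := fun g h v => rfl }
    apply card_dvd_card_of_free_action
    rintro ⟨h, hh⟩ ⟨v, hv⟩ hfix
    have hfix' : h.1 v = v := congrArg Subtype.val hfix
    apply Subtype.ext
    apply Subtype.ext
    ext u
    obtain ⟨k, rfl⟩ := (hfree v hv).2 u
    change h.1 (ι k v) = ι k v
    have hk : σ h k = k := by
      rw [← hρ, MonoidHom.mem_ker.1 hh]; rfl
    rw [← hσ, hk, hfix']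
  have hrange : Nat.card ρ.range ∣ finrank F V := by
    rw [← hfin, ← IsGalois.card_aut_eq_finrank F K]
    exact Subgroup.card_subgroup_dvd_card _
  rw [Subgroup.card_eq_card_quotient_mul_card_subgroup ρ.ker,
    Nat.card_congr (QuotientGroup.quotientKerEquivRange ρ).toEquiv]
  exact mul_dvd_mul hrange hker

end FieldCase

/-! ### Constant fibres and independence of eigenvectors -/

theorem card_eq_card_mul_card_fiber {α β : Type*} [Finite α] [Finite β] (f : α → β)
    (h : ∀ b b', Nat.card {a // f a = b} ≤ Nat.card {a // f a = b'}) (b₀ : β) :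
    Nat.card α = Nat.card β * Nat.card {a // f a = b₀} := by
  have := Fintype.ofFinite β
  rw [← Nat.card_congr (Equiv.sigmaFiberEquiv f), Nat.card_sigma,
    Finset.sum_congr rfl (fun b _ => le_antisymm (h b b₀) (h b₀ b))]
  simp

/-- Dedekind's argument: apply to a relation an operator separating two of the characters and
subtract a multiple of the relation, which removes one term. -/
theorem linearIndependent_of_injective_character {F M ι β : Type*} [Field F] [AddCommGroup M]
    [Module F M] (r : ι → M) (T : β → M →ₗ[F] M) (χ : ι → β → F)
    (hT : ∀ i b, T b (r i) = χ i b • r i) (hr : ∀ i, r i ≠ 0) (hχ : Function.Injective χ) :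
    LinearIndependent F r := by
  classical
  rw [linearIndependent_iff']
  intro s
  induction s using Finset.induction_on with
  | empty => simp
  | insert a s ha ih =>
    intro c hc
    rw [Finset.sum_insert ha] at hc
    have hs : ∀ i ∈ s, c i = 0 := by
      intro i hi
      have hne : χ i ≠ χ a := fun h => ha (hχ h ▸ hi)
      obtain ⟨b, hb⟩ := Function.ne_iff.1 hne
      have h1 := congrArg (T b) hc
      have h2 := congrArg (χ a b • ·) hc
      simp only [map_add, map_smul, map_sum, hT, map_zero, smul_add, Finset.smul_sum,
        smul_zero] at h1 h2
      have h3 : ∑ j ∈ s, (c j * (χ j b - χ a b)) • r j = 0 := by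
        rw [← sub_eq_zero.2 (h1.trans h2.symm), smul_comm, add_sub_add_left_eq_sub,
          ← Finset.sum_sub_distrib]
        refine Finset.sum_congr rfl fun j _ => ?_
        rw [mul_sub, sub_smul, mul_smul, mul_comm, mul_smul]
      exact (mul_eq_zero.1 (ih _ h3 i hi)).resolve_right (sub_ne_zero.2 hb)
    rw [Finset.sum_eq_zero (fun i hi => by rw [hs i hi, zero_smul]), add_zero] at hc
    intro i hi
    rcases Finset.mem_insert.1 hi with rfl | hi
    · exact (smul_eq_zero.1 hc).resolve_right (hr _)
    · exact hs i hi

/-! ### Arithmetic for the double count -/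

section Arithmetic

theorem sq_le_three_pow (n : ℕ) (hn : 7 ≤ n) : n ^ 2 ≤ 3 ^ (n - 3) := by
  induction n, hn using Nat.le_induction with
  | base => norm_num
  | succ k hk ih =>
    rw [show k + 1 - 3 = (k - 3) + 1 by omega, pow_succ 3]
    nlinarith

/-- For `n ≥ 7` the estimate `n ^ 2 ≤ q ^ (n - 3)` contradicts `D < n ^ 2`. For `n = 4` the number
`q ^ 2 + q + 1` divides `D`, leaving `D = 13`; for `n = 5` the number `q ^ 2 + 1` does, leaving 10
and 20; for `n = 6` nothing survives. -/
theorem plane_orbit_arithmetic {q n D M : ℕ} (hq : q.Prime) (hq3 : 3 ≤ q) (hn : 4 ≤ n)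
    (hD0 : 0 < D) (hD : D < n ^ 2) (h : D * (q ^ 2 - 1) = M * (q ^ (n - 1) - 1)) :
    q = 3 ∧ (D = 10 ∨ D = 13 ∨ D = 20) := by
  have hq2 : 9 ≤ q ^ 2 := by nlinarith
  have hM : 0 < M := by
    rcases Nat.eq_zero_or_pos M with rfl | h0
    · rw [zero_mul, mul_eq_zero] at h
      omega
    · exact h0
  have hle : q ^ (n - 1) - 1 ≤ D * (q ^ 2 - 1) := h ▸ Nat.le_mul_of_pos_left _ hM
  by_cases h7 : 7 ≤ n
  · exfalso
    have h1 : n ^ 2 ≤ q ^ (n - 3) := (sq_le_three_pow n h7).trans (Nat.pow_le_pow_left hq3 _)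
    have h2 : q ^ (n - 1) = q ^ (n - 3) * q ^ 2 := by rw [← pow_add]; congr 1; omega
    have h3 : n ^ 2 * q ^ 2 ≤ q ^ (n - 1) := h2 ▸ Nat.mul_le_mul_right _ h1
    have h4 : D * (q ^ 2 - 1) ≤ (n ^ 2 - 1) * (q ^ 2 - 1) := Nat.mul_le_mul_right _ (by omega)
    obtain ⟨x, hx⟩ : ∃ x, q ^ 2 = x + 1 := ⟨q ^ 2 - 1, by omega⟩
    obtain ⟨y, hy⟩ : ∃ y, n ^ 2 = y + 1 := ⟨n ^ 2 - 1, by omega⟩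
    rw [hx, hy] at h3 h4
    rw [hx] at hle
    simp only [Nat.add_sub_cancel] at h4 hle
    have h5 : y * x + y + x + 1 ≤ q ^ (n - 1) := by linarith
    have : 49 ≤ n ^ 2 := by nlinarith
    omega
  · obtain rfl | rfl | rfl : n = 4 ∨ n = 5 ∨ n = 6 := by omega
    · obtain ⟨x, rfl⟩ : ∃ x, q = x + 1 := ⟨q - 1, by omega⟩
      have e1 : (x + 1) ^ 2 - 1 = x * (x + 2) := by
        rw [Nat.sub_eq_iff_eq_add (by omega)]; ring
      have e2 : (x + 1) ^ (4 - 1) - 1 = x * (x ^ 2 + 3 * x + 3) := by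
        rw [Nat.sub_eq_iff_eq_add (Nat.one_le_pow _ _ (by omega))]; ring
      rw [e1, e2] at h
      have h' : D * (x + 2) = M * (x ^ 2 + 3 * x + 3) := by
        apply Nat.eq_of_mul_eq_mul_left (show 0 < x by omega)
        linarith
      have hcop : Nat.Coprime (x ^ 2 + 3 * x + 3) (x + 2) := by
        rw [show x ^ 2 + 3 * x + 3 = 1 + (x + 2) * (x + 1) by ring]
        simp
      have hdvd : x ^ 2 + 3 * x + 3 ∣ D := hcop.dvd_of_dvd_mul_right (h' ▸ dvd_mul_left _ _)
      have hle' := Nat.le_of_dvd hD0 hdvd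
      have hx : x = 2 := by nlinarith
      subst hx
      norm_num at hdvd hD ⊢
      omega
    · have e2 : q ^ (5 - 1) - 1 = (q ^ 2 - 1) * (q ^ 2 + 1) := by
        obtain ⟨x, hx⟩ : ∃ x, q ^ 2 = x + 1 := ⟨q ^ 2 - 1, by omega⟩
        rw [show q ^ (5 - 1) = q ^ 2 * q ^ 2 by ring, hx, Nat.add_sub_cancel,
          Nat.sub_eq_iff_eq_add (by nlinarith)]
        ring
      rw [e2] at h
      have h' : D = M * (q ^ 2 + 1) := by
        apply Nat.eq_of_mul_eq_mul_left (show 0 < q ^ 2 - 1 by omega)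
        linarith
      have hq5 : q < 5 := by nlinarith
      have : q = 3 := by
        interval_cases q
        · rfl
        · norm_num at hq
      subst this
      norm_num at h' hD ⊢
      omega
    · have hq5 : q < 5 := by
        by_contra! h5
        have h1 : D * (q ^ 2 - 1) ≤ 35 * (q ^ 2 - 1) := Nat.mul_le_mul_right _ (by omega)
        have h2 : 35 * q ^ 2 ≤ q ^ (6 - 1) := by
          rw [show q ^ (6 - 1) = q ^ 3 * q ^ 2 by ring]
          apply Nat.mul_le_mul_right
          calc 35 ≤ 5 ^ 3 := by norm_num
            _ ≤ q ^ 3 := Nat.pow_le_pow_left h5 3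
        omega
      have : q = 3 := by
        interval_cases q
        · rfl
        · norm_num at hq
      subst this
      norm_num at h hD
      omega

/-- A positive difference of two powers of two has odd part `2 ^ k - 1`, whereas 20, 26 and 40 have
odd parts 5, 13 and 5. Since `2 ^ c ≤ 2 * D`, only finitely many exponents need checking. -/
theorem two_pow_add_ne {a c D : ℕ} (hD : D = 10 ∨ D = 13 ∨ D = 20) :
    2 ^ a ≠ 2 ^ c + 2 * D := by
  intro h
  have hca : c < a := by
    by_contra! hac
    have := Nat.pow_le_pow_right (n := 2) (by norm_num) hac
    omega
  have h1 : 2 ^ (c + 1) ≤ 2 ^ a := Nat.pow_le_pow_right (by norm_num) hca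
  rw [pow_succ] at h1
  have hc : c < 6 := by
    by_contra! hc
    have := Nat.pow_le_pow_right (n := 2) (by norm_num) hc
    omega
  have ha : a < 7 := by
    by_contra! ha
    have := Nat.pow_le_pow_right (n := 2) (by norm_num) ha
    omega
  interval_cases a <;> interval_cases c <;> omega

end Arithmetic

/-! ### Excluding normalised subgroups with scalar commutators and scalar centre -/

section SymplecticType

set_option linter.unusedSectionVars false

variable {F V : Type*} [Field F] [Finite F] [AddCommGroup V] [Module F V] [Finite V] [Nontrivial V]

instance : Finite (V ≃ₗ[F] V) := Finite.of_injective _ DFunLike.coe_injective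

omit [Finite F] in
-- Conjugation by `B` multiplies each coset representative by scalars, so representatives are
-- simultaneous eigenvectors in `End V`. Two with the same character differ by an element central in
-- `B`, hence scalar. So distinct cosets give independent vectors in a space of dimension `n ^ 2`.
theorem card_quotient_scalar_le {B : Subgroup (V ≃ₗ[F] V)}
    (hcomm : ∀ a ∈ B, ∀ b ∈ B, IsScalarAut (a * b * a⁻¹ * b⁻¹))
    (hcenter : ∀ a ∈ B, (∀ b ∈ B, a * b = b * a) → IsScalarAut a) :
    Nat.card (B ⧸ (scalarSubgroup F V).subgroupOf B) ≤ finrank F V ^ 2 := by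
  let r : B ⧸ (scalarSubgroup F V).subgroupOf B → B := Quotient.out
  choose χ hχ using fun (i : B ⧸ (scalarSubgroup F V).subgroupOf B) (b : B) =>
    hcomm b.1 b.2 (r i).1 (r i).2
  let T : B → Module.End F V →ₗ[F] Module.End F V := fun b =>
    (LinearMap.mulLeft F (b.1 : Module.End F V)) ∘ₗ
      (LinearMap.mulRight F ((b.1⁻¹ : V ≃ₗ[F] V) : Module.End F V))
  have hli : LinearIndependent F (fun i => ((r i).1 : Module.End F V)) := by
    refine linearIndependent_of_injective_character _ T χ ?_ ?_ ?_
    · intro i b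
      ext v
      have := hχ i b ((r i).1 v)
      refine Eq.trans ?_ this
      change b.1 ((r i).1 (b.1⁻¹ v)) = b.1 ((r i).1 (b.1⁻¹ ((r i).1⁻¹ ((r i).1 v))))
      rw [← LinearEquiv.mul_apply ((r i).1⁻¹), inv_mul_cancel]
      rfl
    · intro i h
      obtain ⟨v, hv⟩ := exists_ne (0 : V)
      exact hv ((r i).1.map_eq_zero_iff.1 (LinearMap.congr_fun h v))
    · intro i j hij
      rw [← QuotientGroup.out_eq' i, ← QuotientGroup.out_eq' j]
      apply QuotientGroup.eq.2
      rw [Subgroup.mem_subgroupOf, mem_scalarSubgroup]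
      apply hcenter _ (Subtype.prop _)
      intro b hb
      have e : b * (r i).1 * b⁻¹ * (r i).1⁻¹ = b * (r j).1 * b⁻¹ * (r j).1⁻¹ := by
        ext v
        rw [hχ i ⟨b, hb⟩, hχ j ⟨b, hb⟩, hij]
      change ((r i).1⁻¹ * (r j).1) * b = b * ((r i).1⁻¹ * (r j).1)
      have e2 : (r i).1⁻¹ * (r j).1 =
          (b * (r i).1 * b⁻¹)⁻¹ * (b * (r i).1 * b⁻¹ * (r i).1⁻¹) * (r j).1 := by group
      rw [e] at e2
      conv_lhs => rw [e2]
      group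
  have := Fintype.ofFinite (B ⧸ (scalarSubgroup F V).subgroupOf B)
  have h := hli.fintype_card_le_finrank
  rwa [finrank_linearMap, ← sq, ← Nat.card_eq_fintype_card] at h

/-- The elements of `B` stabilising the line spanned by `w`. -/
def lineStabilizer (B : Subgroup (V ≃ₗ[F] V)) (w : V) : Subgroup (V ≃ₗ[F] V) where
  carrier := {b | b ∈ B ∧ ∃ c : F, b w = c • w}
  one_mem' := ⟨B.one_mem, 1, by simp⟩
  mul_mem' := by
    rintro a b ⟨ha, c, hc⟩ ⟨hb, d, hd⟩
    exact ⟨B.mul_mem ha hb, d * c, by rw [LinearEquiv.mul_apply, hd, map_smul, hc, mul_smul]⟩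
  inv_mem' := by
    rintro a ⟨ha, c, hc⟩
    refine ⟨B.inv_mem ha, c⁻¹, ?_⟩
    have e : a⁻¹ (a w) = w := by rw [← LinearEquiv.mul_apply, inv_mul_cancel]; rfl
    by_cases h0 : c = 0
    · rw [h0, zero_smul] at hc
      rw [(a.map_eq_zero_iff).1 hc]
      simp
    · rw [hc, map_smul] at e
      rw [eq_inv_smul_iff₀ h0, e]

omit [Finite F] [Finite V] [Nontrivial V] in
theorem not_linearIndependent_pair_iff {b : V ≃ₗ[F] V} {w : V} (hw : w ≠ 0) :
    ¬ LinearIndependent F ![w, b w] ↔ ∃ c : F, b w = c • w := by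
  rw [LinearIndependent.pair_iff' hw]
  push Not
  exact exists_congr fun c => eq_comm

variable (B : Subgroup (V ≃ₗ[F] V))

/-- The pairs `(w, b)` with `b ∈ B` not stabilising the line spanned by `w ≠ 0`. -/
abbrev MovedPair : Type _ :=
  {x : V × (V ≃ₗ[F] V) // x.2 ∈ B ∧ LinearIndependent F ![x.1, x.2 x.1]}

variable {B}

/-- The action of the normaliser of `B` on the pairs `(w, b)`. -/
def MovedPair.conj {H : Subgroup (V ≃ₗ[F] V)} (hB : NormalizedBy B H) (h : H) (x : MovedPair B) :
    MovedPair B :=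
  ⟨(h.1 x.1.1, h.1 * x.1.2 * h.1⁻¹), hB h.1 h.2 _ x.2.1, by
    have h1 := x.2.2.map' (h.1 : V →ₗ[F] V) (LinearEquiv.ker _)
    have e : (h.1 : V →ₗ[F] V) ∘ ![x.1.1, x.1.2 x.1.1] =
        ![h.1 x.1.1, (h.1 * x.1.2 * h.1⁻¹) (h.1 x.1.1)] := by
      funext i
      fin_cases i
      · rfl
      · change h.1 (x.1.2 x.1.1) = h.1 (x.1.2 (h.1⁻¹ (h.1 x.1.1)))
        rw [← LinearEquiv.mul_apply h.1⁻¹, inv_mul_cancel]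
        rfl
    rwa [e] at h1⟩

theorem MovedPair.conj_injective {H : Subgroup (V ≃ₗ[F] V)} (hB : NormalizedBy B H) (h : H) :
    Function.Injective (MovedPair.conj hB h) := by
  rintro ⟨⟨w, b⟩, hx⟩ ⟨⟨w', b'⟩, hx'⟩ hxx
  have h1 := congrArg Subtype.val hxx
  simp only [MovedPair.conj, Prod.mk.injEq, EmbeddingLike.apply_eq_iff_eq, mul_left_inj,
    mul_right_inj] at h1
  exact Subtype.ext (Prod.ext h1.1 h1.2)

/-- The plane spanned by `w` and `b w`. -/
def MovedPair.plane (x : MovedPair B) : Plane F V := spanPlane ⟨_, x.2.2⟩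

/-- The nonzero vector `w` of the pair `(w, b)`. -/
def MovedPair.vec (x : MovedPair B) : {v : V // v ≠ 0} := ⟨x.1.1, x.2.2.ne_zero 0⟩

theorem spanPlane_eq_iff (s : {s : Fin 2 → V // LinearIndependent F s}) (U : Plane F V) :
    spanPlane s = U ↔ ∀ i, s.1 i ∈ U.1 := by
  constructor
  · rintro rfl i
    exact Submodule.subset_span (Set.mem_range_self i)
  · intro h
    apply Subtype.ext
    apply Submodule.eq_of_le_of_finrank_eq
    · change Submodule.span F _ ≤ _
      rw [Submodule.span_le]
      rintro _ ⟨i, rfl⟩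
      exact h i
    · rw [U.2]; exact (spanPlane _).2

theorem linearIndependent_pair_scale {w : V} {b : V ≃ₗ[F] V} (h : LinearIndependent F ![w, b w])
    (c d : Fˣ) :
    LinearIndependent F ![c • w, (DistribMulAction.toModuleAut F V d * b) (c • w)] := by
  have := h.units_smul ![c, d * c]
  convert this using 1
  ext i
  fin_cases i
  · rfl
  · change d • (b ((c : F) • w)) = (d * c) • b w
    rw [map_smul, mul_smul]
    rfl

/-- The vector `w` and the automorphism `b` can be rescaled independently without changing the plane
of `w` and `b w`, and this action of two copies of the units is free. -/
theorem MovedPair.sq_dvd_card_fiber (hBs : scalarSubgroup F V ≤ B) (U : Plane F V) :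
    (Nat.card F - 1) * (Nat.card F - 1) ∣ Nat.card {x : MovedPair B // x.plane = U} := by
  rw [← Nat.card_units, ← Nat.card_prod]
  let act : MulAction (Fˣ × Fˣ) {x : MovedPair B // x.plane = U} :=
    { smul := fun c x => ⟨⟨(c.1 • x.1.1.1, DistribMulAction.toModuleAut F V c.2 * x.1.1.2),
        B.mul_mem (hBs ⟨c.2, rfl⟩) x.1.2.1, linearIndependent_pair_scale x.1.2.2 c.1 c.2⟩, by
          have hx := (spanPlane_eq_iff _ _).1 x.2
          refine (spanPlane_eq_iff _ _).2 fun i => ?_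
          fin_cases i
          · exact U.1.smul_mem c.1.1 (hx 0)
          · change c.2.1 • (x.1.1.2 (c.1.1 • x.1.1.1)) ∈ U.1
            rw [map_smul]
            exact U.1.smul_mem _ (U.1.smul_mem _ (hx 1))⟩
      one_smul := by
        rintro ⟨⟨⟨w, b⟩, hx⟩, hU⟩
        apply Subtype.ext
        apply Subtype.ext
        refine Prod.ext (one_smul _ _) ?_
        change DistribMulAction.toModuleAut F V (1 : Fˣ) * b = b
        rw [map_one, one_mul]
      mul_smul := by
        rintro ⟨c, d⟩ ⟨c', d'⟩ ⟨⟨⟨w, b⟩, hx⟩, hU⟩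
        apply Subtype.ext
        apply Subtype.ext
        refine Prod.ext (mul_smul _ _ _) ?_
        change DistribMulAction.toModuleAut F V (d * d') * b = _ * (_ * b)
        rw [map_mul, mul_assoc] }
  apply card_dvd_card_of_free_action
  rintro ⟨c, d⟩ ⟨⟨⟨w, b⟩, hx⟩, hU⟩ hfix
  have h1 := congrArg (fun y => y.1.1) hfix
  have hw : w ≠ 0 := hx.2.ne_zero 0
  have h2 : (c : F) • w = w := congrArg Prod.fst h1
  have h3 : DistribMulAction.toModuleAut F V d * b = b := congrArg Prod.snd h1
  rw [mul_eq_right] at h3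
  have h4 : (d : F) • w = w := LinearEquiv.congr_fun h3 w
  have key : ∀ e : Fˣ, (e : F) • w = w → e = 1 := fun e he =>
    Units.ext (smul_left_injective F hw (he.trans (one_smul F w).symm))
  exact Prod.ext (key c h2) (key d h4)

/-- The elements of `B` moving the line spanned by `w`. -/
abbrev LineMover (B : Subgroup (V ≃ₗ[F] V)) (w : V) : Type _ :=
  {b : V ≃ₗ[F] V // b ∈ B ∧ LinearIndependent F ![w, b w]}

theorem dvd_card_lineMover (hBs : scalarSubgroup F V ≤ B) {w : V} :
    Nat.card F - 1 ∣ Nat.card (LineMover B w) := by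
  rw [← Nat.card_units]
  let act : MulAction Fˣ (LineMover B w) :=
    { smul := fun d b => ⟨DistribMulAction.toModuleAut F V d * b.1,
        B.mul_mem (hBs ⟨d, rfl⟩) b.2.1, by
          simpa using linearIndependent_pair_scale b.2.2 1 d⟩
      one_smul := fun b => by
        apply Subtype.ext
        change DistribMulAction.toModuleAut F V (1 : Fˣ) * b.1 = b.1
        rw [map_one, one_mul]
      mul_smul := fun d d' b => by
        apply Subtype.ext
        change DistribMulAction.toModuleAut F V (d * d') * b.1 = _ * (_ * b.1)
        rw [map_mul, mul_assoc] }
  apply card_dvd_card_of_free_action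
  rintro d ⟨b, hb⟩ hfix
  have h3 : DistribMulAction.toModuleAut F V d * b = b := congrArg Subtype.val hfix
  rw [mul_eq_right] at h3
  obtain ⟨v, hv⟩ := exists_ne (0 : V)
  have h4 : (d : F) • v = v := LinearEquiv.congr_fun h3 v
  exact Units.ext (smul_left_injective F hv (h4.trans (one_smul F v).symm))

theorem card_lineStabilizer_add_card_lineMover {w : V} (hw : w ≠ 0) :
    Nat.card (lineStabilizer B w) + Nat.card (LineMover B w) = Nat.card B := by
  classical
  rw [← Nat.card_congr (Equiv.sumCompl (fun b : B => b.1 ∈ lineStabilizer B w)), Nat.card_sum]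
  congr 1
  · refine Nat.card_congr ⟨fun b => ⟨⟨b.1, b.2.1⟩, b.2⟩, fun b => ⟨b.1.1, b.2⟩, fun _ => rfl,
      fun _ => rfl⟩
  · have key : ∀ b : B, ¬ b.1 ∈ lineStabilizer B w ↔ LinearIndependent F ![w, b.1 w] := by
      intro b
      rw [iff_comm, ← not_iff_not, not_not, not_linearIndependent_pair_iff hw]
      exact ⟨fun h => ⟨b.2, h⟩, fun h => h.2⟩
    refine Nat.card_congr ⟨fun b => ⟨⟨b.1, b.2.1⟩, (key _).2 b.2.2⟩,
      fun b => ⟨b.1.1, b.1.2, (key _).1 b.2⟩, fun _ => rfl, fun _ => rfl⟩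

/-- Moved pairs are counted over planes and over nonzero vectors; both maps have constant fibres by
transitivity. With fibres of size `(q - 1) ^ 2 * M` and `(q - 1) * D` this gives `D * (q ^ 2 - 1) =
M * (q ^ (n - 1) - 1)`, where `D < n ^ 2`. Arithmetic leaves `q = 3`; then `B` and its line
stabilizer have 2-power orders differing by `2 * D`, which is impossible. -/
theorem not_isPlaneTransitive_of_symplecticType {H : Subgroup (V ≃ₗ[F] V)}
    (hH : IsPlaneTransitive H) (hF : (Nat.card F).Prime) (hn : 4 ≤ finrank F V)
    (hB : NormalizedBy B H) (hBs : scalarSubgroup F V ≤ B)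
    (hcomm : ∀ a ∈ B, ∀ b ∈ B, IsScalarAut (a * b * a⁻¹ * b⁻¹))
    (hcenter : ∀ a ∈ B, (∀ b ∈ B, a * b = b * a) → IsScalarAut a)
    (hns : ∃ b ∈ B, ¬ IsScalarAut b) (hF2 : Nat.card F ≠ 2) : False := by
  set q := Nat.card F with hq
  set n := finrank F V with hn'
  have hq3 : 3 ≤ q := by have := hF.two_le; omega
  obtain ⟨b₁, hb₁, hb₁s⟩ := hns
  obtain ⟨w, hw⟩ : ∃ w, LinearIndependent F ![w, b₁ w] := by
    by_contra! hcon
    apply hb₁s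
    apply isScalarAut_of_forall_eigenvector
    intro v
    by_cases hv : v = 0
    · exact ⟨0, by simp [hv]⟩
    · exact (not_linearIndependent_pair_iff hv).1 (hcon v)
  have hw0 : w ≠ 0 := hw.ne_zero 0
  let x₀ : MovedPair B := ⟨(w, b₁), hb₁, hw⟩
  -- counting along the planes
  have hplane : Nat.card (MovedPair B) =
      Nat.card (Plane F V) * Nat.card {x : MovedPair B // x.plane = x₀.plane} := by
    apply card_eq_card_mul_card_fiber
    intro U U'
    obtain ⟨h, hh, hU⟩ := hH.plane U.1 U'.1 U.2 U'.2
    refine Nat.card_le_card_of_injective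
      (fun x => ⟨MovedPair.conj hB ⟨h, hh⟩ x.1, ?_⟩) ?_
    · refine (spanPlane_eq_iff _ _).2 fun i => ?_
      have hx := (spanPlane_eq_iff _ _).1 x.2
      rw [← hU]
      fin_cases i
      · exact ⟨_, hx 0, rfl⟩
      · refine ⟨_, hx 1, ?_⟩
        change h (x.1.1.2 x.1.1.1) = h (x.1.1.2 (h⁻¹ (h x.1.1.1)))
        rw [← LinearEquiv.mul_apply h⁻¹, inv_mul_cancel]
        rfl
    · intro x y hxy
      exact Subtype.ext (MovedPair.conj_injective hB _ (congrArg Subtype.val hxy))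
  have hvec : Nat.card (MovedPair B) = (q ^ n - 1) * Nat.card (LineMover B w) := by
    rw [← card_nonzero (F := F) (V := V)]
    rw [card_eq_card_mul_card_fiber (MovedPair.vec (B := B)) ?_ ⟨w, hw0⟩]
    · congr 1
      refine Nat.card_congr ⟨fun x => ⟨x.1.1.2, x.1.2.1, ?_⟩,
        fun b => ⟨⟨(w, b.1), b.2.1, b.2.2⟩, rfl⟩, ?_, fun _ => rfl⟩
      · have := x.1.2.2
        rwa [show x.1.1.1 = w from congrArg Subtype.val x.2] at this
      · rintro ⟨⟨⟨v, b⟩, hx⟩, hv⟩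
        obtain rfl : v = w := congrArg Subtype.val hv
        rfl
    · intro v v'
      obtain ⟨h, hh, hv⟩ := hH.vec v.1 v'.1 v.2 v'.2
      refine Nat.card_le_card_of_injective
        (fun x => ⟨MovedPair.conj hB ⟨h, hh⟩ x.1, ?_⟩) ?_
      · have hx : x.1.1.1 = v.1 := congrArg Subtype.val x.2
        apply Subtype.ext
        change h x.1.1.1 = v'.1
        rw [hx, hv]
      · intro x y hxy
        exact Subtype.ext (MovedPair.conj_injective hB _ (congrArg Subtype.val hxy))
  have hmpos : 0 < Nat.card (LineMover B w) := by
    have : Nonempty (LineMover B w) := ⟨⟨b₁, hb₁, hw⟩⟩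
    exact Nat.card_pos
  obtain ⟨M, hM⟩ := MovedPair.sq_dvd_card_fiber hBs x₀.plane
  obtain ⟨D, hD⟩ := dvd_card_lineMover hBs (w := w)
  have hT := card_plane_mul (F := F) (V := V) (by omega)
  rw [← hq, ← hn'] at hT
  rw [← hq] at hM hD
  rw [hvec, hM, hD] at hplane
  have hscalar : q - 1 ≤ Nat.card (lineStabilizer B w) := by
    rw [hq, ← card_scalarSubgroup (F := F) (V := V)]
    refine Subgroup.card_le_of_le fun g hg => ⟨hBs hg, ?_⟩
    obtain ⟨c, hc⟩ := mem_scalarSubgroup.1 hg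
    exact ⟨c, hc w⟩
  have hBcard : Nat.card B ≤ n ^ 2 * (q - 1) := by
    rw [Subgroup.card_eq_card_quotient_mul_card_subgroup ((scalarSubgroup F V).subgroupOf B),
      Nat.card_congr (Subgroup.subgroupOfEquivOfLe hBs).toEquiv, card_scalarSubgroup, ← hq]
    exact Nat.mul_le_mul_right _ (card_quotient_scalar_le hcomm hcenter)
  have hsum := card_lineStabilizer_add_card_lineMover (B := B) hw0
  rw [hD] at hsum
  have hD0 : 0 < D := by
    rw [hD] at hmpos
    exact Nat.pos_of_mul_pos_left hmpos
  -- Strict, because the scalars in `B` stabilise the line of `w`, so at least `q - 1` elements of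
  -- `B` are not movers.
  have hDn : D < n ^ 2 := by
    have h1 : (q - 1) * (D + 1) ≤ (q - 1) * n ^ 2 := by
      rw [mul_add, mul_one, mul_comm _ (n ^ 2)]
      omega
    have := Nat.le_of_mul_le_mul_left h1 (by omega)
    omega
  have heq : D * (q ^ 2 - 1) = M * (q ^ (n - 1) - 1) := by
    have e1 : q ^ 2 - q = (q - 1) * q := by rw [Nat.sub_mul, sq, one_mul]
    have e2 : q ^ n - q = (q ^ (n - 1) - 1) * q := by
      rw [Nat.sub_mul, ← pow_succ, one_mul, Nat.sub_add_cancel (by omega)]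
    rw [e1, e2] at hT
    have hqn : 0 < q ^ n - 1 := by
      have := Nat.one_lt_pow (n := n) (by omega) (show 1 < q by omega)
      omega
    have hpos : 0 < (q ^ n - 1) * ((q - 1) * ((q - 1) * q)) :=
      Nat.mul_pos hqn (Nat.mul_pos (by omega) (Nat.mul_pos (by omega) (by omega)))
    apply Nat.eq_of_mul_eq_mul_left hpos
    calc (q ^ n - 1) * ((q - 1) * ((q - 1) * q)) * (D * (q ^ 2 - 1))
        = ((q ^ n - 1) * ((q - 1) * D)) * ((q ^ 2 - 1) * ((q - 1) * q)) := by ring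
      _ = (q - 1) * (q - 1) * M * (Nat.card (Plane F V) * ((q ^ 2 - 1) * ((q - 1) * q))) := by
          rw [hplane]; ring
      _ = _ := by rw [hT]; ring
  obtain ⟨hq', hD'⟩ := plane_orbit_arithmetic hF hq3 hn hD0 hDn heq
  -- the field has three elements, so `B` is a `2`-group
  have hF3 : ∀ g : V ≃ₗ[F] V, IsScalarAut g → g ^ 2 = 1 := by
    intro g hg
    obtain ⟨c, rfl⟩ := mem_scalarSubgroup.2 hg
    have : c ^ 2 = 1 := by
      have h1 : Nat.card Fˣ = 2 := by rw [Nat.card_units]; omega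
      rw [← h1]; exact pow_card_eq_one'
    rw [← map_pow, this, map_one]
  have hpg : IsPGroup 2 B := by
    intro b
    -- Exponent four suffices: commutators are scalars of square 1, so `b ^ 2` commutes with `B` and
    -- is a scalar, whose square is 1.
    refine ⟨2, ?_⟩
    have hb2 : IsScalarAut (b.1 ^ 2) := by
      apply hcenter _ (B.pow_mem b.2 2)
      intro c hc
      obtain hz := hF3 _ (hcomm c hc b.1 b.2)
      obtain ⟨d, hd⟩ := hcomm c hc b.1 b.2
      set z := c * b.1 * c⁻¹ * b.1⁻¹ with hz'
      have hzc : ∀ g, z * g = g * z := by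
        intro g
        ext v
        change z (g v) = g (z v)
        rw [hd, hd, map_smul]
      have e1 : c * b.1 * c⁻¹ = z * b.1 := by rw [hz']; group
      have e2 : c * b.1 ^ 2 * c⁻¹ = (c * b.1 * c⁻¹) ^ 2 := by rw [conj_pow]
      rw [e1, (show Commute z b.1 from hzc _).mul_pow, hz, one_mul] at e2
      exact (mul_inv_eq_iff_eq_mul.1 e2).symm
    have := hF3 _ hb2
    rw [← pow_mul] at this
    exact Subtype.ext this
  obtain ⟨a, ha⟩ := IsPGroup.iff_card.1 hpg
  obtain ⟨c, hc⟩ := IsPGroup.iff_card.1 (hpg.to_le (H := lineStabilizer B w) fun b hb => hb.1)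
  rw [ha, hc, hq'] at hsum
  exact two_pow_add_ne hD' hsum.symm

end SymplecticType

/-- The last nontrivial term of the derived series. -/
theorem exists_normal_isMulCommutative_ne_bot (G : Type*) [Group G] [Nontrivial G]
    (hG : Group.IsSolvable G) :
    ∃ N : Subgroup G, N.Normal ∧ N ≠ ⊥ ∧ ∀ a ∈ N, ∀ b ∈ N, a * b = b * a := by
  classical
  have hex : ∃ n, derivedSeries G n = ⊥ := hG.solvable
  obtain ⟨m, hm⟩ : ∃ m, Nat.find hex = m + 1 := by
    apply Nat.exists_eq_succ_of_ne_zero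
    intro h0
    have := Nat.find_spec hex
    rw [h0, derivedSeries_zero] at this
    exact top_ne_bot this
  refine ⟨derivedSeries G m, derivedSeries_normal G m, Nat.find_min hex (by omega), ?_⟩
  intro a ha b hb
  have h1 := Nat.find_spec hex
  rw [hm, derivedSeries_succ] at h1
  have h2 := Subgroup.commutator_mem_commutator ha hb
  rw [h1, Subgroup.mem_bot, commutatorElement_eq_one_iff_mul_comm] at h2
  exact h2

/-! ### Solvable linear groups transitive on vectors and planes -/

section SolvableLinear

variable {F V : Type*} [Field F] [Finite F] [AddCommGroup V] [Module F V] [Finite V] [Nontrivial V]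

/-- A nonscalar abelian normalised subgroup is irreducible and gives the semilinear bound. Failing
that, the preimage `B` of an abelian normal subgroup of `H` modulo scalars is of the excluded kind;
over the field of two elements there are no nontrivial scalars, so `B` would itself be abelian and
nonscalar. -/
theorem IsPlaneTransitive.card_dvd {H : Subgroup (V ≃ₗ[F] V)} (hH : IsPlaneTransitive H)
    (hs : Group.IsSolvable H) (hF : (Nat.card F).Prime) (hn : 2 ≤ finrank F V)
    (h4 : 4 ≤ finrank F V ∨ Nat.card F = 2) :
    Nat.card H ∣ finrank F V * (Nat.card F ^ finrank F V - 1) := by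
  by_cases hA : ∃ A : Subgroup (V ≃ₗ[F] V), NormalizedBy A H ∧ (∀ a ∈ A, ∀ b ∈ A, a * b = b * a) ∧
      ∃ a ∈ A, ¬ IsScalarAut a
  · obtain ⟨A, hAH, hcomm, a, ha, has⟩ := hA
    refine card_dvd_of_irreducible_abelian hAH hcomm ?_
    exact (hH.scalar_or_irreducible hAH).resolve_left fun h => has (h a ha)
  exfalso
  push Not at hA
  set Z := scalarSubgroup F V with hZ
  have hZc : ∀ z ∈ Z, ∀ g, z * g = g * z := by
    rintro _ hz g
    obtain ⟨c, hc⟩ := mem_scalarSubgroup.1 hz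
    ext v
    rw [LinearEquiv.mul_apply, LinearEquiv.mul_apply, hc, hc, map_smul]
  have hZn : (Z.subgroupOf H).Normal := by
    refine ⟨fun z hz g => ?_⟩
    rw [Subgroup.mem_subgroupOf] at hz ⊢
    have : g * z * g⁻¹ = z := Subtype.ext (by
      change g.1 * z.1 * g.1⁻¹ = z.1
      rw [← hZc _ hz]; group)
    rwa [this]
  have hnt : Nontrivial (H ⧸ Z.subgroupOf H) := by
    obtain ⟨v, hv⟩ := exists_ne (0 : V)
    obtain ⟨w, hw⟩ := exists_linearIndependent_pair_of_one_lt_finrank (R := F) (by omega) hv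
    obtain ⟨h, hh, hvw⟩ := hH.vec v w hv (hw.ne_zero 1)
    refine ⟨QuotientGroup.mk ⟨h, hh⟩, 1, fun h1 => ?_⟩
    rw [QuotientGroup.eq_one_iff, Subgroup.mem_subgroupOf, mem_scalarSubgroup] at h1
    obtain ⟨c, hc⟩ := h1
    exact (LinearIndependent.pair_iff' hv).1 hw c (by rw [← hvw]; exact (hc v).symm)
  obtain ⟨N, hN, hN0, hNc⟩ := exists_normal_isMulCommutative_ne_bot (H ⧸ Z.subgroupOf H)
    inferInstance
  set B := (N.comap (QuotientGroup.mk' (Z.subgroupOf H))).map H.subtype with hB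
  have hmem : ∀ b : V ≃ₗ[F] V, b ∈ B ↔ ∃ hb : b ∈ H,
      QuotientGroup.mk' (Z.subgroupOf H) ⟨b, hb⟩ ∈ N := by
    intro b
    constructor
    · rintro ⟨⟨x, hx⟩, hxN, rfl⟩
      exact ⟨hx, hxN⟩
    · rintro ⟨hb, hbN⟩
      exact ⟨⟨b, hb⟩, hbN, rfl⟩
  have hBH : NormalizedBy B H := by
    intro h hh b hb
    obtain ⟨hbH, hbN⟩ := (hmem b).1 hb
    exact (hmem _).2 ⟨H.mul_mem (H.mul_mem hh hbH) (H.inv_mem hh),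
      hN.conj_mem _ hbN (QuotientGroup.mk' (Z.subgroupOf H) ⟨h, hh⟩)⟩
  have hZH : Z ≤ H := fun g hg => hH.scalar g (mem_scalarSubgroup.1 hg)
  have hZB : Z ≤ B := by
    intro z hz
    refine (hmem z).2 ⟨hZH hz, ?_⟩
    rw [(QuotientGroup.eq_one_iff _).2 (Subgroup.mem_subgroupOf.2 hz)
      |> fun h => (h : QuotientGroup.mk' (Z.subgroupOf H) ⟨z, hZH hz⟩ = 1)]
    exact N.one_mem
  have hcomm : ∀ a ∈ B, ∀ b ∈ B, IsScalarAut (a * b * a⁻¹ * b⁻¹) := by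
    intro a ha b hb
    obtain ⟨haH, haN⟩ := (hmem a).1 ha
    obtain ⟨hbH, hbN⟩ := (hmem b).1 hb
    have h1 := hNc _ haN _ hbN
    have h2 : QuotientGroup.mk' (Z.subgroupOf H)
        (⟨a, haH⟩ * ⟨b, hbH⟩ * ⟨a, haH⟩⁻¹ * ⟨b, hbH⟩⁻¹) = 1 := by
      rw [map_mul, map_mul, map_mul, map_inv, map_inv, h1]
      group
    exact mem_scalarSubgroup.1 (Subgroup.mem_subgroupOf.1 ((QuotientGroup.eq_one_iff _).1 h2))
  have hcenter : ∀ a ∈ B, (∀ b ∈ B, a * b = b * a) → IsScalarAut a := by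
    intro a ha hab
    -- The centre of `B` is abelian and normalised by `H`, so it is scalar by assumption.
    refine hA (B ⊓ Subgroup.centralizer B) ?_ ?_ a ⟨ha, ?_⟩
    · rintro h hh n ⟨hn, hn'⟩
      refine ⟨hBH h hh n hn, ?_⟩
      rintro b hb
      have hb' : h⁻¹ * b * h ∈ B := by simpa using hBH h⁻¹ (H.inv_mem hh) b hb
      have := hn' _ hb'
      calc b * (h * n * h⁻¹) = h * (h⁻¹ * b * h * n) * h⁻¹ := by group
        _ = h * (n * (h⁻¹ * b * h)) * h⁻¹ := by rw [this]
        _ = _ := by group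
    · rintro x ⟨-, hx⟩ y ⟨hy, -⟩
      exact (hx y hy).symm
    · exact fun b hb => (hab b hb).symm
  have hns : ∃ b ∈ B, ¬ IsScalarAut b := by
    obtain ⟨⟨x, hxN⟩, hx1⟩ := N.ne_bot_iff_exists_ne_one.1 hN0
    obtain ⟨⟨b, hb⟩, hbx⟩ := QuotientGroup.mk'_surjective (Z.subgroupOf H) x
    refine ⟨b, (hmem b).2 ⟨hb, hbx ▸ hxN⟩, fun hbs => hx1 ?_⟩
    apply Subtype.ext
    refine hbx.symm.trans ?_
    exact (QuotientGroup.eq_one_iff _).2 (Subgroup.mem_subgroupOf.2 (mem_scalarSubgroup.2 hbs))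
  by_cases h2 : Nat.card F = 2
  · obtain ⟨b, hb, hbs⟩ := hns
    refine hbs (hA B hBH ?_ b hb)
    have hZ1 : Z = ⊥ := by
      rw [← Subgroup.card_eq_one, hZ, card_scalarSubgroup, h2]
    intro x hx y hy
    have := mem_scalarSubgroup.2 (hcomm x hx y hy)
    rw [← hZ, hZ1, Subgroup.mem_bot] at this
    rwa [mul_inv_eq_one, mul_inv_eq_iff_eq_mul] at this
  · exact not_isPlaneTransitive_of_symplecticType hH hF (h4.resolve_right h2) hBH hZB hcomm
      hcenter hns h2

omit [Nontrivial V] in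
theorem card_plane_mul' (h : 2 ≤ finrank F V) (hF : 2 ≤ Nat.card F) :
    Nat.card (Plane F V) * ((Nat.card F ^ 2 - 1) * (Nat.card F - 1)) =
      (Nat.card F ^ finrank F V - 1) * (Nat.card F ^ (finrank F V - 1) - 1) := by
  have hT := card_plane_mul (F := F) (V := V) h
  set q := Nat.card F
  set n := finrank F V
  have e1 : q ^ 2 - q = (q - 1) * q := by rw [Nat.sub_mul, sq, one_mul]
  have e2 : q ^ n - q = (q ^ (n - 1) - 1) * q := by
    rw [Nat.sub_mul, ← pow_succ, one_mul, Nat.sub_add_cancel (by omega)]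
  rw [e1, e2] at hT
  apply Nat.eq_of_mul_eq_mul_right (show 0 < q by omega)
  linarith

theorem two_pow_gt (n : ℕ) (hn : 6 ≤ n) : n < 2 ^ (n - 3) := by
  induction n, hn using Nat.le_induction with
  | base => norm_num
  | succ k hk ih =>
    rw [show k + 1 - 3 = (k - 3) + 1 by omega, pow_succ 2]
    omega

/-- Size rules out `n ≥ 6`. For `n = 4` the factor `q ^ 2 + q + 1`, coprime to `q + 1`, would divide
4; for `n = 5` the factor `q ^ 2 + 1` divides 5. -/
theorem semilinear_arithmetic {q n : ℕ} (hq : 2 ≤ q) (hn : 4 ≤ n)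
    (h : q ^ (n - 1) - 1 ∣ n * (q ^ 2 - 1)) : n = 5 ∧ q = 2 := by
  have hq2 : 4 ≤ q ^ 2 := by nlinarith
  by_cases h6 : 6 ≤ n
  · exfalso
    have hle := Nat.le_of_dvd (Nat.mul_pos (by omega) (by omega)) h
    have h1 : n + 1 ≤ q ^ (n - 3) := (two_pow_gt n h6).trans_le (Nat.pow_le_pow_left hq _)
    have h2 : q ^ (n - 1) = q ^ (n - 3) * q ^ 2 := by rw [← pow_add]; congr 1; omega
    have h3 : (n + 1) * q ^ 2 ≤ q ^ (n - 1) := h2 ▸ Nat.mul_le_mul_right _ h1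
    have h4 : n * (q ^ 2 - 1) ≤ n * q ^ 2 := Nat.mul_le_mul_left _ (by omega)
    rw [add_mul, one_mul] at h3
    omega
  · obtain ⟨x, rfl⟩ : ∃ x, q = x + 1 := ⟨q - 1, by omega⟩
    have e1 : (x + 1) ^ 2 - 1 = x * (x + 2) := by
      rw [Nat.sub_eq_iff_eq_add (by omega)]; ring
    obtain rfl | rfl : n = 4 ∨ n = 5 := by omega
    · exfalso
      have e2 : (x + 1) ^ (4 - 1) - 1 = x * (x ^ 2 + 3 * x + 3) := by
        rw [Nat.sub_eq_iff_eq_add (Nat.one_le_pow _ _ (by omega))]; ring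
      rw [e1, e2, mul_left_comm 4] at h
      have h' := Nat.dvd_of_mul_dvd_mul_left (show 0 < x by omega) h
      have hcop : Nat.Coprime (x ^ 2 + 3 * x + 3) (x + 2) := by
        rw [show x ^ 2 + 3 * x + 3 = 1 + (x + 2) * (x + 1) by ring]
        simp
      have := Nat.le_of_dvd (by norm_num) (hcop.dvd_of_dvd_mul_right h')
      nlinarith
    · have e2 : (x + 1) ^ (5 - 1) - 1 = x * ((x + 2) * (x ^ 2 + 2 * x + 2)) := by
        rw [Nat.sub_eq_iff_eq_add (Nat.one_le_pow _ _ (by omega))]; ring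
      rw [e1, e2, mul_left_comm 5] at h
      have h' := Nat.dvd_of_mul_dvd_mul_left (show 0 < x by omega) h
      rw [mul_comm 5] at h'
      have := Nat.le_of_dvd (by norm_num) (Nat.dvd_of_mul_dvd_mul_left (show 0 < x + 2 by omega) h')
      refine ⟨rfl, ?_⟩
      nlinarith

theorem IsPlaneTransitive.finrank_eq_five {H : Subgroup (V ≃ₗ[F] V)} (hH : IsPlaneTransitive H)
    (hs : Group.IsSolvable H) (hF : (Nat.card F).Prime) (hn : 4 ≤ finrank F V) :
    finrank F V = 5 ∧ Nat.card F = 2 := by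
  have h1 := (hH.card_plane_mul_dvd (by omega)).trans (hH.card_dvd hs hF (by omega) (Or.inl hn))
  have hT := card_plane_mul' (F := F) (V := V) (by omega) hF.two_le
  have hq := hF.two_le
  refine semilinear_arithmetic hq hn ?_
  set q := Nat.card F
  set n := finrank F V
  have h2 := Nat.mul_dvd_mul_right h1 (q ^ 2 - 1)
  have hqn : 0 < q ^ n - 1 := by
    have := Nat.one_lt_pow (n := n) (by omega) (show 1 < q by omega)
    omega
  apply Nat.dvd_of_mul_dvd_mul_left hqn
  convert h2 using 1
  · rw [← hT]; ring
  · ring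

/-- A solvable group of linear automorphisms of a space of dimension at least `4` over a field of
prime order, transitive on lines and on planes, exists only on `F₂⁵`. -/
theorem finrank_eq_five_of_transitive {G : Type*} [Group G] (hG : Group.IsSolvable G)
    (ρ : G →* (V ≃ₗ[F] V)) (hF : (Nat.card F).Prime) (hn : 4 ≤ finrank F V)
    (hline : ∀ v w : V, v ≠ 0 → w ≠ 0 → ∃ g, ∃ c : Fˣ, c • ρ g v = w)
    (hplane : ∀ U W : Submodule F V, finrank F U = 2 → finrank F W = 2 →
      ∃ g, U.map (ρ g : V →ₗ[F] V) = W) :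
    finrank F V = 5 ∧ Nat.card F = 2 := by
  let σ : Fˣ →* (V ≃ₗ[F] V) := DistribMulAction.toModuleAut F V
  -- Adjoining the scalars keeps the image solvable and turns transitivity on lines into
  -- transitivity on nonzero vectors.
  let τ : Fˣ × G →* (V ≃ₗ[F] V) := MonoidHom.noncommCoprod σ ρ (fun c g => by
    ext v
    exact ((ρ g).map_smul (c : F) v).symm)
  have hτ : ∀ c g, τ (c, g) = σ c * ρ g := fun c g => rfl
  have hs : Group.IsSolvable τ.range := Group.isSolvable_of_surjective τ.rangeRestrict_surjective
  refine IsPlaneTransitive.finrank_eq_five (H := τ.range) ⟨?_, ?_, ?_⟩ hs hF hn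
  · intro v w hv hw
    obtain ⟨g, c, h⟩ := hline v w hv hw
    exact ⟨τ (c, g), ⟨_, rfl⟩, h⟩
  · intro U W hU hW
    obtain ⟨g, h⟩ := hplane U W hU hW
    refine ⟨τ (1, g), ⟨_, rfl⟩, ?_⟩
    rw [hτ, map_one, one_mul, h]
  · intro g hg
    obtain ⟨c, rfl⟩ := mem_scalarSubgroup.2 hg
    exact ⟨(c, 1), by rw [hτ, map_one, mul_one]⟩

/-- The possible orders of a solvable linear group over the field with two elements which is
transitive on nonzero vectors and on planes. -/
theorem card_range_of_transitive {G : Type*} [Group G] (hG : Group.IsSolvable G)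
    (ρ : G →* (V ≃ₗ[F] V)) (hF : Nat.card F = 2) (hn : 2 ≤ finrank F V)
    (hline : ∀ v w : V, v ≠ 0 → w ≠ 0 → ∃ g, ∃ c : Fˣ, c • ρ g v = w)
    (hplane : ∀ U W : Submodule F V, finrank F U = 2 → finrank F W = 2 →
      ∃ g, U.map (ρ g : V →ₗ[F] V) = W) :
    Nat.card ρ.range ∣ finrank F V * (2 ^ finrank F V - 1) ∧
      2 ^ finrank F V - 1 ∣ Nat.card ρ.range ∧
      (finrank F V = 5 → 155 ∣ Nat.card ρ.range) := by
  have hunits : ∀ c : Fˣ, c = 1 := by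
    have : Nat.card Fˣ = 1 := by rw [Nat.card_units, hF]
    have := (Nat.card_eq_one_iff_unique.1 this).1
    exact fun c => Subsingleton.elim _ _
  have hH : IsPlaneTransitive ρ.range := by
    refine ⟨?_, ?_, ?_⟩
    · intro v w hv hw
      obtain ⟨g, c, h⟩ := hline v w hv hw
      rw [hunits c, one_smul] at h
      exact ⟨ρ g, ⟨_, rfl⟩, h⟩
    · intro U W hU hW
      obtain ⟨g, h⟩ := hplane U W hU hW
      exact ⟨ρ g, ⟨_, rfl⟩, h⟩
    · intro g hg
      obtain ⟨c, rfl⟩ := mem_scalarSubgroup.2 hg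
      rw [hunits c, map_one]
      exact ρ.range.one_mem
  have hs : Group.IsSolvable ρ.range := Group.isSolvable_of_surjective ρ.rangeRestrict_surjective
  refine ⟨?_, ?_, ?_⟩
  · have := hH.card_dvd hs (hF ▸ Nat.prime_two) hn (Or.inr hF)
    rwa [hF] at this
  · have := hH.card_nonzero_dvd
    rwa [hF] at this
  · intro h5
    have h1 := hH.card_plane_mul_dvd hn
    have h2 := card_plane_mul' (F := F) (V := V) hn hF.ge
    rw [hF, h5] at h2
    rw [hF] at h1
    norm_num at h1 h2
    have : Nat.card (Plane F V) = 155 := by omega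
    rwa [this] at h1

end SolvableLinear

/-- Any two abelian `p`-subgroups of `G` of equal order are conjugate in `G`. -/
def IsApiAt (p : ℕ) (G : Type*) [Group G] : Prop :=
  ∀ (n : ℕ) (A B : Subgroup G), IsMulCommutative A → IsMulCommutative B →
    Nat.card A = p ^ n → Nat.card B = p ^ n → ∃ g : G, A.map (MulAut.conj g).toMonoidHom = B

/-! ### Passing to the quotient by the largest normal `p'`-subgroup -/

section PrimeToPCore

set_option linter.unusedSectionVars false

variable {X : Type*} [Group X] [Finite X] {p : ℕ}

theorem coprime_card_sup {M N : Subgroup X} [N.Normal] (hN : (Nat.card N).Coprime p)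
    (hM : (Nat.card M).Coprime p) : (Nat.card (N ⊔ M : Subgroup X)).Coprime p := by
  have h1 : Nat.card (N ⊔ M : Subgroup X) = Nat.card N * N.relIndex M := by
    rw [← Subgroup.relIndex_sup_left, ← Subgroup.relIndex_bot_left, ← Subgroup.relIndex_bot_left]
    exact (Subgroup.relIndex_mul_relIndex ⊥ N _ bot_le le_sup_left).symm
  rw [h1]
  exact Nat.Coprime.mul_left hN (hM.coprime_dvd_left (Subgroup.relIndex_dvd_card _ _))

theorem exists_primeToPCore (X : Type*) [Group X] [Finite X] (p : ℕ) :
    ∃ N : Subgroup X, N.Normal ∧ (Nat.card N).Coprime p ∧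
      ∀ M : Subgroup X, M.Normal → (Nat.card M).Coprime p → M ≤ N := by
  obtain ⟨N, hN⟩ := (Set.toFinite {N : Subgroup X | N.Normal ∧ (Nat.card N).Coprime p}).exists_maximal
    ⟨⊥, inferInstance, by simp⟩
  have := hN.1.1
  refine ⟨N, hN.1.1, hN.1.2, fun M hM hMp => ?_⟩
  exact le_sup_right.trans (hN.2 ⟨inferInstance, coprime_card_sup hN.1.2 hMp⟩ le_sup_left)

theorem oddCore_primeToTwo (X : Type*) [Group X] [Finite X] :
    (Nat.card (oddCore X)).Coprime 2 ∧
      ∀ M : Subgroup X, M.Normal → (Nat.card M).Coprime 2 → M ≤ oddCore X := by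
  obtain ⟨N, hN, hN2, hmax⟩ := exists_primeToPCore X 2
  have : oddCore X = N := by
    apply le_antisymm
    · exact sSup_le fun M hM => hmax M hM.1 (Nat.coprime_two_right.2 hM.2)
    · exact le_sSup ⟨hN, Nat.coprime_two_right.1 hN2⟩
  rw [this]
  exact ⟨hN2, hmax⟩

theorem eq_bot_of_normal_quotient {N : Subgroup X} [N.Normal] (hN : (Nat.card N).Coprime p)
    (hmax : ∀ M : Subgroup X, M.Normal → (Nat.card M).Coprime p → M ≤ N)
    (M : Subgroup (X ⧸ N)) (hM : M.Normal) (hMp : (Nat.card M).Coprime p) : M = ⊥ := by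
  have h1 : (M.comap (QuotientGroup.mk' N)) ≤ N := by
    apply hmax _ inferInstance
    have h2 := Subgroup.card_eq_card_quotient_mul_card_subgroup
      (((QuotientGroup.mk' N).subgroupComap M).ker)
    have h3 : Function.Surjective ((QuotientGroup.mk' N).subgroupComap M) :=
      MonoidHom.subgroupComap_surjective_of_surjective _ _ (QuotientGroup.mk'_surjective N)
    rw [Nat.card_congr (QuotientGroup.quotientKerEquivOfSurjective _ h3).toEquiv] at h2
    rw [h2]
    refine Nat.Coprime.mul_left hMp (hN.coprime_dvd_left ?_)
    have h4 : ((QuotientGroup.mk' N).subgroupComap M).ker.map (Subgroup.subtype _) ≤ N := by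
      rintro _ ⟨x, hx, rfl⟩
      exact (QuotientGroup.eq_one_iff _).1 (congrArg Subtype.val (MonoidHom.mem_ker.1 hx))
    rw [← Subgroup.card_map_of_injective (Subgroup.subtype_injective _)]
    exact Subgroup.card_dvd_of_le h4
  rw [eq_bot_iff]
  intro m hm
  obtain ⟨x, rfl⟩ := QuotientGroup.mk'_surjective N m
  exact (QuotientGroup.eq_one_iff x).2 (h1 hm)

variable [Fact p.Prime]

theorem mk'_injOn_of_isPGroup {N : Subgroup X} [N.Normal] (hN : (Nat.card N).Coprime p)
    {P : Subgroup X} (hP : IsPGroup p P) {x y : X} (hx : x ∈ P) (hy : y ∈ P)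
    (hxy : QuotientGroup.mk' N x = QuotientGroup.mk' N y) : x = y := by
  have h1 : x⁻¹ * y ∈ P ⊓ N := ⟨P.mul_mem (P.inv_mem hx) hy, QuotientGroup.eq.1 hxy⟩
  have h2 : P ⊓ N = ⊥ := by
    apply (Subgroup.disjoint_of_coprime_natCard _).eq_bot
    obtain ⟨k, hk⟩ := IsPGroup.iff_card.1 hP
    rw [hk]
    exact (Nat.Coprime.pow_right k hN).symm
  rw [h2, Subgroup.mem_bot] at h1
  exact inv_mul_eq_one.1 h1

/-- A Sylow `p`-subgroup of the preimage of `A` maps onto a Sylow `p`-subgroup of `A`, which is `A`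
itself. -/
theorem exists_lift_of_isPGroup {N : Subgroup X} [N.Normal] {A : Subgroup (X ⧸ N)}
    (hA : IsPGroup p A) :
    ∃ P : Subgroup X, IsPGroup p P ∧ P.map (QuotientGroup.mk' N) = A := by
  set C := A.comap (QuotientGroup.mk' N) with hC
  have hsurj : Function.Surjective ((QuotientGroup.mk' N).subgroupComap A) :=
    MonoidHom.subgroupComap_surjective_of_surjective _ _ (QuotientGroup.mk'_surjective N)
  obtain ⟨P⟩ := (inferInstance : Nonempty (Sylow p C))
  refine ⟨P.1.map C.subtype, P.2.map _, ?_⟩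
  have h1 : (P.mapSurjective hsurj : Subgroup A) = ⊤ :=
    ((P.mapSurjective hsurj).3 (Q := ⊤) (hA.to_subgroup _) le_top).symm
  rw [Sylow.coe_mapSurjective] at h1
  ext a
  constructor
  · rintro ⟨_, ⟨x, -, rfl⟩, rfl⟩
    exact x.2
  · intro ha
    have h2 : (⟨a, ha⟩ : A) ∈ (⊤ : Subgroup A) := trivial
    rw [← h1] at h2
    obtain ⟨x, hx, hxa⟩ := h2
    exact ⟨x, ⟨x, hx, rfl⟩, congrArg Subtype.val hxa⟩

/-- A `p`-subgroup is isomorphic to its image modulo a normal `p'`-subgroup. -/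
noncomputable def equivMapOfIsPGroup {N : Subgroup X} [N.Normal] (hN : (Nat.card N).Coprime p)
    {P : Subgroup X} (hP : IsPGroup p P) : P ≃* P.map (QuotientGroup.mk' N) :=
  MulEquiv.ofBijective ((QuotientGroup.mk' N).subgroupMap P)
    ⟨fun x y hxy => Subtype.ext
      (mk'_injOn_of_isPGroup hN hP x.2 y.2 (congrArg Subtype.val hxy)),
      (QuotientGroup.mk' N).subgroupMap_surjective P⟩

/-- Abelian `p`-subgroups of the quotient lift isomorphically, so their lifts are abelian of the
same order; a conjugator upstairs projects to one downstairs. -/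
theorem IsApiAt.quotient (hX : IsApiAt p X) {N : Subgroup X} [N.Normal]
    (hN : (Nat.card N).Coprime p) : IsApiAt p (X ⧸ N) := by
  have key : ∀ (n : ℕ) (A : Subgroup (X ⧸ N)), IsMulCommutative A → Nat.card A = p ^ n →
      ∃ P : Subgroup X, IsMulCommutative P ∧ Nat.card P = p ^ n ∧
        P.map (QuotientGroup.mk' N) = A := by
    intro n A hA hcard
    obtain ⟨P, hP, rfl⟩ := exists_lift_of_isPGroup (IsPGroup.of_card hcard)
    let e := equivMapOfIsPGroup hN hP
    refine ⟨P, ⟨⟨fun x y => e.injective ?_⟩⟩, (Nat.card_congr e.toEquiv).trans hcard, rfl⟩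
    rw [map_mul, map_mul]
    exact hA.is_comm.comm _ _
  intro n A B hA hB hAn hBn
  obtain ⟨P, hP, hPn, rfl⟩ := key n A hA hAn
  obtain ⟨Q, hQ, hQn, rfl⟩ := key n B hB hBn
  obtain ⟨g, rfl⟩ := hX n P Q hP hQ hPn hQn
  refine ⟨QuotientGroup.mk' N g, ?_⟩
  rw [Subgroup.map_map, Subgroup.map_map]
  congr 1

end PrimeToPCore

/-! ### Normal `p`-subgroups of solvable groups -/

section LocalStructure

open scoped commutatorElement IsMulCommutative

variable {G : Type*} [Group G] [Finite G] {p : ℕ} [Fact p.Prime]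

/-- Take the elements of order dividing `p` in the centre of `N`, which is nontrivial because `N` is
a nontrivial `p`-group. -/
theorem exists_normal_elementary {N : Subgroup G} (hN : N.Normal) (hp : IsPGroup p N)
    (hN0 : N ≠ ⊥) : ∃ E : Subgroup G, E.Normal ∧ E ≠ ⊥ ∧ E ≤ N ∧
      (∀ x ∈ E, ∀ y ∈ N, x * y = y * x) ∧ ∀ x ∈ E, x ^ p = 1 := by
  let E : Subgroup G :=
    { carrier := {x | x ∈ N ∧ (∀ y ∈ N, x * y = y * x) ∧ x ^ p = 1}
      one_mem' := ⟨N.one_mem, fun y _ => by simp, one_pow _⟩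
      mul_mem' := by
        rintro a b ⟨ha, ha', hap⟩ ⟨hb, hb', hbp⟩
        refine ⟨N.mul_mem ha hb, fun y hy => ?_, ?_⟩
        · rw [mul_assoc, hb' y hy, ← mul_assoc, ha' y hy, mul_assoc]
        · rw [(show Commute a b from ha' b hb).mul_pow, hap, hbp, one_mul]
      inv_mem' := by
        rintro a ⟨ha, ha', hap⟩
        exact ⟨N.inv_mem ha, fun y hy => ((show Commute a y from ha' y hy).inv_left).eq,
          by rw [inv_pow, hap, inv_one]⟩ }
  have hE : ∀ x, x ∈ E ↔ x ∈ N ∧ (∀ y ∈ N, x * y = y * x) ∧ x ^ p = 1 := fun x => Iff.rfl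
  refine ⟨E, ⟨?_⟩, ?_, fun x hx => hx.1, fun x hx => hx.2.1, fun x hx => hx.2.2⟩
  · rintro x ⟨hx, hx', hxp⟩ g
    refine ⟨hN.conj_mem x hx g, fun y hy => ?_, ?_⟩
    · have := hx' (g⁻¹ * y * g) (by simpa using hN.conj_mem y hy g⁻¹)
      calc g * x * g⁻¹ * y = g * (x * (g⁻¹ * y * g)) * g⁻¹ := by group
        _ = g * ((g⁻¹ * y * g) * x) * g⁻¹ := by rw [this]
        _ = _ := by group
    · rw [conj_pow, hxp]; group
  · have hnt : Nontrivial N := (Subgroup.nontrivial_iff_ne_bot N).2 hN0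
    have hc := hp.center_nontrivial
    have hpc : IsPGroup p (Subgroup.center N) := hp.to_subgroup _
    obtain ⟨k, hk, hcard⟩ := hpc.nontrivial_iff_card.1 hc
    obtain ⟨z, hz⟩ := exists_prime_orderOf_dvd_card' (G := Subgroup.center N) p
      (hcard ▸ dvd_pow_self p hk.ne')
    rw [Subgroup.ne_bot_iff_exists_ne_one]
    refine ⟨⟨z.1.1, z.1.2, fun y hy => ?_, ?_⟩, fun h => ?_⟩
    · exact congrArg Subtype.val ((Subgroup.mem_center_iff.1 z.2 ⟨y, hy⟩).symm)
    · have := pow_orderOf_eq_one z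
      rw [hz] at this
      exact congrArg (fun w => w.1.1) this
    · have h1 : z.1.1 = 1 := congrArg Subtype.val h
      have h2 : z = 1 := Subtype.ext (Subtype.ext h1)
      rw [h2, orderOf_one] at hz
      exact (Fact.out : p.Prime).one_lt.ne hz

/-- In a solvable group without nontrivial normal `p'`-subgroups the largest normal `p`-subgroup
contains its centralizer. -/
theorem exists_normal_pGroup_centralizer_le (hG : Group.IsSolvable G)
    (hcore : ∀ M : Subgroup G, M.Normal → (Nat.card M).Coprime p → M = ⊥) :
    ∃ T : Subgroup G, T.Normal ∧ IsPGroup p T ∧ Subgroup.centralizer (T : Set G) ≤ T ∧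
      ∀ M : Subgroup G, M.Normal → IsPGroup p M → M ≤ T := by
  obtain ⟨T, hT⟩ := (Set.toFinite {T : Subgroup G | T.Normal ∧ IsPGroup p T}).exists_maximal
    ⟨⊥, inferInstance, IsPGroup.of_bot⟩
  have hTn := hT.1.1
  have hTmax : ∀ M : Subgroup G, M.Normal → IsPGroup p M → M ≤ T := fun M hM hMp =>
    le_sup_right.trans (hT.2 ⟨inferInstance, hT.1.2.to_sup_of_normal_right hMp⟩ le_sup_left)
  refine ⟨T, hTn, hT.1.2, ?_, hTmax⟩
  by_contra hC
  -- By minimality the commutator subgroup of `M` lies in `T`, which `M` centralizes, so `M` is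
  -- nilpotent. Its Sylow subgroups for other primes are normal in `G`, hence trivial; thus `M` is a
  -- `p`-group and lies in `T` after all.
  obtain ⟨M, hM⟩ := (Set.toFinite {M : Subgroup G | M.Normal ∧
    M ≤ Subgroup.centralizer (T : Set G) ∧ ¬ M ≤ T}).exists_minimal
    ⟨Subgroup.centralizer (T : Set G), inferInstance, le_rfl, hC⟩
  have hMn := hM.1.1
  have hM0 : M ≠ ⊥ := by
    rintro rfl
    exact hM.1.2.2 bot_le
  have hlt := Group.IsSolvable.commutator_lt_of_ne_bot hM0
  have hle : ⁅M, M⁆ ≤ T := by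
    by_contra hcon
    exact hlt.not_ge (hM.2 ⟨inferInstance, hlt.le.trans hM.1.2.1, hcon⟩ hlt.le)
  have hnil : Group.IsNilpotent M := by
    apply Group.of_quotient_center_nilpotent
    have : IsMulCommutative (M ⧸ Subgroup.center M) := by
      refine ⟨⟨fun a b => ?_⟩⟩
      obtain ⟨a, rfl⟩ := QuotientGroup.mk_surjective a
      obtain ⟨b, rfl⟩ := QuotientGroup.mk_surjective b
      rw [← QuotientGroup.mk_mul, ← QuotientGroup.mk_mul, eq_comm, QuotientGroup.eq,
        Subgroup.mem_center_iff]
      intro c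
      have h1 := Subgroup.commutator_mem_commutator (M.inv_mem a.2) (M.inv_mem b.2)
      have h2 := hM.1.2.1 c.2 _ (hle h1)
      apply Subtype.ext
      have h3 : (((b * a)⁻¹ * (a * b) : M) : G) = ⁅a.1⁻¹, b.1⁻¹⁆ := by
        rw [commutatorElement_def]
        push_cast
        group
      rw [← h3] at h2
      exact h2.symm
    exact CommGroup.isNilpotent
  have hsyl := ((Group.isNilpotent_of_finite_tfae (G := M)).out 0 3).1 hnil
  have hMp : IsPGroup p M := by
    have : Nat.card M = p ^ (Nat.card M).primeFactorsList.length := by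
      apply Nat.eq_prime_pow_of_unique_prime_dvd Nat.card_pos.ne'
      intro r hr hrd
      by_contra hrp
      have : Fact r.Prime := ⟨hr⟩
      obtain ⟨P⟩ := (inferInstance : Nonempty (Sylow r M))
      have hPn : P.1.Normal := hsyl r inferInstance P
      have hPc : P.1.Characteristic := P.characteristic_of_normal hPn
      have hPG : (P.1.map M.subtype).Normal := inferInstance
      have hbot := hcore _ hPG (by
        rw [Subgroup.card_map_of_injective M.subtype_injective]
        obtain ⟨k, hk⟩ := IsPGroup.iff_card.1 P.2
        rw [hk]
        exact Nat.Coprime.pow_left k ((Nat.coprime_primes hr Fact.out).2 hrp))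
      rw [Subgroup.map_eq_bot_iff_of_injective _ M.subtype_injective] at hbot
      exact P.ne_bot_of_dvd_card hrd hbot
    exact IsPGroup.of_card this
  exact hM.1.2.2 (hTmax M hMn hMp)

end LocalStructure

/-! ### Commutator identities and the quaternion relations -/

section Words

variable {G : Type*} [Group G]

theorem pow_mul_of_commutator {y w c : G} (h : w * y = y * w * c) (hw : Commute c w) (n : ℕ) :
    w ^ n * y = y * w ^ n * c ^ n := by
  induction n with
  | zero => simp
  | succ k ih =>
    calc w ^ (k + 1) * y = w ^ k * (w * y) := by rw [pow_succ, mul_assoc]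
      _ = (w ^ k * y) * w * c := by rw [h]; group
      _ = y * w ^ k * (c ^ k * w) * c := by rw [ih]; group
      _ = y * w ^ k * (w * c ^ k) * c := by rw [(hw.pow_left k).eq]
      _ = _ := by rw [pow_succ, pow_succ]; group

theorem mul_pow_of_commutator {y w c : G} (h : w * y = y * w * c) (hw : Commute c w)
    (hy : Commute c y) (n : ℕ) : (y * w) ^ n = y ^ n * w ^ n * c ^ n.choose 2 := by
  induction n with
  | zero => simp
  | succ k ih =>
    calc (y * w) ^ (k + 1) = y ^ k * w ^ k * (c ^ k.choose 2 * (y * w)) := by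
          rw [pow_succ, ih, mul_assoc]
      _ = y ^ k * w ^ k * ((y * w) * c ^ k.choose 2) := by
          rw [((hy.mul_right hw).pow_left _).eq]
      _ = y ^ k * (w ^ k * y) * w * c ^ k.choose 2 := by group
      _ = y ^ k * (y * w ^ k * (c ^ k * w)) * c ^ k.choose 2 := by rw [pow_mul_of_commutator h hw]; group
      _ = y ^ k * (y * w ^ k * (w * c ^ k)) * c ^ k.choose 2 := by rw [(hw.pow_left k).eq]
      _ = _ := by
        rw [Nat.choose_succ_succ' k 1, Nat.choose_one_right, pow_add, pow_succ, pow_succ]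
        group

/-- This reduces showing that `S` contains all `p`-elements to elements whose `p`-th power already
lies in `S`. -/
theorem exists_pow_notMem_pow_mem {p k : ℕ} {S : Subgroup G} {x : G} (hx : x ∉ S)
    (hk : x ^ p ^ k = 1) : ∃ j, x ^ p ^ j ∉ S ∧ (x ^ p ^ j) ^ p ∈ S := by
  classical
  have hex : ∃ k, x ^ p ^ k ∈ S := ⟨k, hk ▸ S.one_mem⟩
  obtain ⟨m, hm⟩ : ∃ m, Nat.find hex = m + 1 := by
    apply Nat.exists_eq_succ_of_ne_zero
    intro h0
    have := Nat.find_spec hex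
    rw [h0] at this
    exact hx (by simpa using this)
  refine ⟨m, Nat.find_min hex (by omega), ?_⟩
  rw [← pow_mul, ← pow_succ, ← hm]
  exact Nat.find_spec hex

/-- The homomorphism from the quaternion group of order `8` given by two generators. -/
def quaternionLift {x y : G} (hx : x ^ 4 = 1) (hy : y * y = x ^ 2) (hxy : x * y = y * x⁻¹) :
    QuaternionGroup 2 →* G :=
  have e_add : ∀ i j : ZMod 4, x ^ (i + j).val = x ^ i.val * x ^ j.val := fun i j => by
    rw [← pow_add, ZMod.val_add, ← pow_eq_pow_mod _ hx]
  have e_sub : ∀ i j : ZMod 4, x ^ (i - j).val = (x ^ j.val)⁻¹ * x ^ i.val := fun i j => by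
    rw [eq_inv_mul_iff_mul_eq, ← e_add, add_sub_cancel]
  have e_y : ∀ n : ℕ, x ^ n * y = y * (x ^ n)⁻¹ := fun n => by
    induction n with
    | zero => simp
    | succ k ih => rw [pow_succ, mul_assoc, hxy, ← mul_assoc, ih, mul_inv_rev, mul_assoc,
        ← mul_inv_rev, ← mul_inv_rev, ← pow_succ, ← pow_succ']
  MonoidHom.mk' (fun g => match g with
    | .a i => x ^ (show ZMod 4 from i).val
    | .xa i => y * x ^ (show ZMod 4 from i).val) (by
    rintro (i | i) (j | j)
    · exact e_add i j
    · change y * x ^ (j - i : ZMod 4).val = x ^ (ZMod.val (n := 4) i) * (y * x ^ (ZMod.val (n := 4) j))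
      rw [e_sub, ← mul_assoc (x ^ _), e_y, mul_assoc]
    · change y * x ^ (i + j : ZMod 4).val = y * x ^ (ZMod.val (n := 4) i) * x ^ (ZMod.val (n := 4) j)
      rw [e_add, mul_assoc]
    · change x ^ (2 + j - i : ZMod 4).val =
        y * x ^ (ZMod.val (n := 4) i) * (y * x ^ (ZMod.val (n := 4) j))
      rw [e_sub, e_add, mul_assoc y, ← mul_assoc _ y, e_y, ← mul_assoc, ← mul_assoc, ← mul_assoc y y, hy,
        show ZMod.val (2 : ZMod 4) = 2 from rfl]
      congr 1
      exact ((Commute.refl x).pow_pow _ _).inv_left.eq)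

theorem quaternionLift_a {x y : G} (hx : x ^ 4 = 1) (hy : y * y = x ^ 2) (hxy : x * y = y * x⁻¹)
    (i : ZMod 4) : quaternionLift hx hy hxy (.a i) = x ^ i.val := rfl

theorem quaternionLift_xa {x y : G} (hx : x ^ 4 = 1) (hy : y * y = x ^ 2) (hxy : x * y = y * x⁻¹)
    (i : ZMod 4) : quaternionLift hx hy hxy (.xa i) = y * x ^ i.val := rfl

theorem quaternionLift_injective {x y : G} (hx : x ^ 4 = 1) (hy : y * y = x ^ 2)
    (hxy : x * y = y * x⁻¹) (hx2 : x ^ 2 ≠ 1) (hne : x * y ≠ y * x) :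
    Function.Injective (quaternionLift hx hy hxy) := by
  rw [injective_iff_map_eq_one]
  rintro (i | i) hi
  · have h1 := quaternionLift_a hx hy hxy i
    rw [hi] at h1
    have h2 : i.val < 4 := ZMod.val_lt (n := 4) i
    have h3 : ZMod.val (n := 4) i = 0 := by
      obtain h | h | h | h : ZMod.val (n := 4) i = 0 ∨ ZMod.val (n := 4) i = 1 ∨
        ZMod.val (n := 4) i = 2 ∨ ZMod.val (n := 4) i = 3 := by omega
      · exact h
      · rw [h, pow_one] at h1
        exact absurd (by rw [← h1, one_pow]) hx2
      · rw [h] at h1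
        exact absurd h1.symm hx2
      · rw [h] at h1
        have : x = 1 := by
          have : x ^ 4 = x ^ 3 * x := pow_succ x 3
          rwa [hx, ← h1, one_mul, eq_comm] at this
        exact absurd (by rw [this, one_pow]) hx2
    rw [(ZMod.val_eq_zero (n := 4) i).1 h3]
    rfl
  · exfalso
    have h1 := quaternionLift_xa hx hy hxy i
    rw [hi] at h1
    apply hne
    rw [eq_inv_of_mul_eq_one_left h1.symm]
    exact ((Commute.refl x).pow_right _).inv_right.eq

end Words

/-! ### Consequences of conjugacy of cyclic subgroups -/

section ConjugateSubgroups

set_option linter.unusedSectionVars false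

variable {G : Type*} [Group G] [Finite G] {p : ℕ} [hp : Fact p.Prime]

/-- The cyclic subgroups generated by `x` and `y` are conjugate, and `N` is normal. -/
theorem IsApiAt.mem_normal_of_orderOf_eq (hG : IsApiAt p G) {N : Subgroup G} (hN : N.Normal)
    {x y : G} {k : ℕ} (hx : orderOf x = p ^ k) (hy : orderOf y = p ^ k) (hxN : x ∈ N) : y ∈ N := by
  obtain ⟨g, hg⟩ := hG k (Subgroup.zpowers x) (Subgroup.zpowers y) inferInstance inferInstance
    (by rw [Nat.card_zpowers, hx]) (by rw [Nat.card_zpowers, hy])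
  have h1 : y ∈ (Subgroup.zpowers x).map (MulAut.conj g).toMonoidHom :=
    hg ▸ Subgroup.mem_zpowers y
  obtain ⟨z, hz, rfl⟩ := h1
  exact hN.conj_mem z ((Subgroup.zpowers_le.2 hxN) hz) g

theorem IsApiAt.mem_of_pow_eq_one (hG : IsApiAt p G) {A : Subgroup G} (hA : A.Normal)
    (hc : IsCyclic A) {m : ℕ} (hm : Nat.card A = p ^ m) {x : G} (hx : x ^ p ^ m = 1) : x ∈ A := by
  obtain ⟨a, ha⟩ := hc.exists_generator
  have hao : orderOf a.1 = p ^ m := by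
    rw [Subgroup.orderOf_coe, orderOf_eq_card_of_forall_mem_zpowers ha, hm]
  obtain ⟨j, hj, hxj⟩ := (Nat.dvd_prime_pow hp.out).1 (orderOf_dvd_of_pow_eq_one hx)
  have h2 : orderOf (a.1 ^ p ^ (m - j)) = p ^ j := by
    rw [orderOf_pow_of_dvd (pow_ne_zero _ hp.out.ne_zero) (by
      rw [hao]; exact pow_dvd_pow _ (by omega)), hao, Nat.pow_div (by omega) hp.out.pos]
    congr 1; omega
  exact hG.mem_normal_of_orderOf_eq hA h2 hxj (A.pow_mem a.2 _)

theorem exists_orderOf_eq_prime_pow {x : G} {k : ℕ} (hx : x ^ p ^ k = 1) :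
    ∃ j, orderOf x = p ^ j := by
  obtain ⟨j, -, hj⟩ := (Nat.dvd_prime_pow hp.out).1 (orderOf_dvd_of_pow_eq_one hx)
  exact ⟨j, hj⟩

/-- The conclusion of the local analysis: a normal Sylow `p`-subgroup `S` containing its
centralizer. -/
structure IsNormalSylowSelfCentralizing (p : ℕ) (S : Subgroup G) : Prop where
  normal : S.Normal
  isPGroup : IsPGroup p S
  centralizer_le : Subgroup.centralizer (S : Set G) ≤ S
  mem_of_pow : ∀ (x : G) (k : ℕ), x ^ p ^ k = 1 → x ∈ S

/-- Since `S` contains every `p`-element and `T` every normal `p`-subgroup, `S = T`, and the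
centralizer condition transfers. -/
theorem isNormalSylowSelfCentralizing_of_le {S T : Subgroup G} (hS : S.Normal) (hSp : IsPGroup p S)
    (hTp : IsPGroup p T) (hTc : Subgroup.centralizer (T : Set G) ≤ T)
    (hTmax : ∀ M : Subgroup G, M.Normal → IsPGroup p M → M ≤ T)
    (hmem : ∀ (x : G) (k : ℕ), x ^ p ^ k = 1 → x ∈ S) : IsNormalSylowSelfCentralizing p S := by
  have hTS : T = S := by
    apply le_antisymm
    · intro t ht
      obtain ⟨k, hk⟩ := hTp ⟨t, ht⟩
      exact hmem t k (congrArg Subtype.val hk)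
    · exact hTmax S hS hSp
  exact ⟨hS, hSp, hTS ▸ hTc, hmem⟩

theorem isPGroup_of_forall_pow {E : Subgroup G} (h : ∀ x ∈ E, x ^ p = 1) : IsPGroup p E :=
  fun x => ⟨1, Subtype.ext (by rw [pow_one]; exact h x.1 x.2)⟩

variable {T : Subgroup G}

theorem IsApiAt.exists_elementary (hG : IsApiAt p G) (hTn : T.Normal) (hTp : IsPGroup p T)
    (hTc : Subgroup.centralizer (T : Set G) ≤ T)
    (hTmax : ∀ M : Subgroup G, M.Normal → IsPGroup p M → M ≤ T) (hT0 : T ≠ ⊥)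
    (hno : ∀ g : G, orderOf g ≠ p ^ 2) :
    ∃ S : Subgroup G, IsNormalSylowSelfCentralizing p S ∧ (∀ x ∈ S, ∀ y ∈ S, x * y = y * x) ∧
      ∀ x ∈ S, x ^ p = 1 := by
  obtain ⟨E, hEn, hE0, hET, hEc, hEp⟩ := exists_normal_elementary hTn hTp hT0
  refine ⟨E, isNormalSylowSelfCentralizing_of_le hEn (isPGroup_of_forall_pow hEp) hTp hTc hTmax ?_,
    fun x hx y hy => hEc x hx y (hET hy), hEp⟩
  intro x k hx
  obtain ⟨j, hj⟩ := exists_orderOf_eq_prime_pow hx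
  obtain ⟨⟨e, he⟩, he1⟩ := E.ne_bot_iff_exists_ne_one.1 hE0
  have heo : orderOf e = p ^ 1 := by
    rw [pow_one]
    exact orderOf_eq_prime (hEp e he) fun h => he1 (Subtype.ext h)
  obtain rfl | rfl | h2 : j = 0 ∨ j = 1 ∨ 2 ≤ j := by omega
  · rw [pow_zero, orderOf_eq_one_iff] at hj
    exact hj ▸ E.one_mem
  · exact hG.mem_normal_of_orderOf_eq hEn heo hj he
  · exfalso
    apply hno (x ^ p ^ (j - 2))
    rw [orderOf_pow_of_dvd (pow_ne_zero _ hp.out.ne_zero) (by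
      rw [hj]; exact pow_dvd_pow _ (by omega)), hj, Nat.pow_div (by omega) hp.out.pos]
    congr 1; omega

/-- A larger normal elementary subgroup would contain an abelian group of order `p ^ 2` and exponent
`p`, conjugate to the cyclic group generated by `g`. -/
theorem IsApiAt.exists_normal_card_eq_prime (hG : IsApiAt p G) (hTn : T.Normal)
    (hTp : IsPGroup p T) (hT0 : T ≠ ⊥) {g : G} (hg : orderOf g = p ^ 2) :
    ∃ E : Subgroup G, E.Normal ∧ Nat.card E = p := by
  obtain ⟨E, hEn, hE0, hET, hEc, hEp⟩ := exists_normal_elementary hTn hTp hT0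
  refine ⟨E, hEn, ?_⟩
  obtain ⟨k, hk⟩ := IsPGroup.iff_card.1 (isPGroup_of_forall_pow hEp)
  obtain rfl | rfl | h2 : k = 0 ∨ k = 1 ∨ 2 ≤ k := by omega
  · exact absurd (Subgroup.card_eq_one.1 (by simpa using hk)) hE0
  · simpa using hk
  · exfalso
    obtain ⟨K, hK⟩ := Sylow.exists_subgroup_card_pow_prime (G := E) p
      (hk ▸ pow_dvd_pow p h2)
    obtain ⟨c, hc⟩ := hG 2 (K.map E.subtype) (Subgroup.zpowers g) ⟨⟨by
        rintro ⟨_, x, hx, rfl⟩ ⟨_, y, hy, rfl⟩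
        exact Subtype.ext (hEc x.1 x.2 y.1 (hET y.2))⟩⟩ inferInstance
      (by rw [Subgroup.card_map_of_injective E.subtype_injective, hK])
      (by rw [Nat.card_zpowers, hg])
    have h1 : g ∈ (K.map E.subtype).map (MulAut.conj c).toMonoidHom :=
      hc ▸ Subgroup.mem_zpowers g
    obtain ⟨_, ⟨x, hx, rfl⟩, rfl⟩ := h1
    have h3 : orderOf (c * x.1 * c⁻¹) ∣ p := by
      apply orderOf_dvd_of_pow_eq_one
      rw [conj_pow, hEp x.1 x.2]; group
    have h4 : p ^ 2 ∣ p := hg ▸ h3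
    have := Nat.le_of_dvd hp.out.pos h4
    have := hp.out.two_le
    nlinarith

end ConjugateSubgroups

/-! ### Cyclic and quaternion Sylow subgroups -/

section CyclicNormal

variable {G : Type*} [Group G] [Finite G] {p : ℕ} [hp : Fact p.Prime] {T : Subgroup G}

/-- Two noncommuting elements `x`, `y` of order `4` with common square `a` generating the
quaternion group `D`. -/
structure IsQuaternionPair (D : Subgroup G) (x y : G) : Prop where
  normal : D.Normal
  x_mem : x ∈ D
  y_mem : y ∈ D
  sq_ne : x ^ 2 ≠ 1
  ne : x * y ≠ y * x
  sq_central : ∀ u ∈ D, u * x ^ 2 = x ^ 2 * u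
  sq_sq : (x ^ 2) ^ 2 = 1
  sq_eq : ∀ u ∈ D, u = 1 ∨ u = x ^ 2 ∨ u ^ 2 = x ^ 2
  comm : ∀ u ∈ D, ∀ v ∈ D, u * v = v * u ∨ u * v = v * u * x ^ 2

namespace IsQuaternionPair

variable {D : Subgroup G} {x y : G}

omit [Finite G] in
theorem eq_of_commute (h : IsQuaternionPair D x y) {u v : G} (hu : u ∈ D) (hu2 : u ^ 2 = x ^ 2)
    (hv : v ∈ D) (hc : v * u = u * v) : v = 1 ∨ v = x ^ 2 ∨ v = u ∨ v = x ^ 2 * u := by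
  rcases h.sq_eq v hv with h1 | h1 | h1
  · exact Or.inl h1
  · exact Or.inr (Or.inl h1)
  · have h2 : (v * u⁻¹) ^ 2 = 1 := by
      rw [(show Commute v u from hc).inv_right.mul_pow, h1, inv_pow, hu2, mul_inv_cancel]
    rcases h.sq_eq _ (D.mul_mem hv (D.inv_mem hu)) with h3 | h3 | h3
    · exact Or.inr (Or.inr (Or.inl (mul_inv_eq_one.1 h3)))
    · exact Or.inr (Or.inr (Or.inr (mul_inv_eq_iff_eq_mul.1 h3)))
    · exact absurd (h3.symm.trans h2) h.sq_ne

omit [Finite G] in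
theorem sq_eq_of_ne (h : IsQuaternionPair D x y) {u v : G} (hu : u ∈ D) (hv : v ∈ D)
    (hne : u * v ≠ v * u) : u ^ 2 = x ^ 2 := by
  rcases h.sq_eq u hu with h1 | h1 | h1
  · exact absurd (by rw [h1, one_mul, mul_one]) hne
  · exact absurd (by rw [h1, h.sq_central v hv]) hne
  · exact h1

omit [Finite G] in
-- Both `v` and `w` have the same central commutator `x ^ 2` with `u`, and it cancels in `v * w⁻¹`.
theorem commute_mul_inv (h : IsQuaternionPair D x y) {u v w : G} (hu : u ∈ D) (hv : v ∈ D)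
    (hw : w ∈ D) (hvu : v * u ≠ u * v) (hwu : w * u ≠ u * w) :
    (v * w⁻¹) * u = u * (v * w⁻¹) := by
  have h1 := (h.comm v hv u hu).resolve_left hvu
  have h2 := (h.comm w hw u hu).resolve_left hwu
  have h3 : w⁻¹ * u = x ^ 2 * u * w⁻¹ := by
    rw [inv_mul_eq_iff_eq_mul, ← mul_assoc, ← mul_assoc, h.sq_central w hw, mul_assoc (x ^ 2), h2,
      mul_assoc u w, h.sq_central w hw, ← mul_assoc, ← mul_assoc, ← h.sq_central _ hu, mul_assoc u,
      ← sq, h.sq_sq, mul_one, mul_inv_cancel_right]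
  rw [mul_assoc, h3, ← mul_assoc, ← mul_assoc, h.sq_central v hv, mul_assoc (x ^ 2), h1,
    mul_assoc u v, h.sq_central v hv, ← mul_assoc, ← mul_assoc, ← h.sq_central u hu, mul_assoc u,
    ← sq, h.sq_sq, mul_one, mul_assoc]

omit [Finite G] in
theorem pow_four (h : IsQuaternionPair D x y) : x ^ 4 = 1 := by
  rw [← h.sq_sq, ← pow_mul]

omit [Finite G] in
theorem y_mul_y (h : IsQuaternionPair D x y) : y * y = x ^ 2 := by
  rw [← sq]
  exact h.sq_eq_of_ne h.y_mem h.x_mem h.ne.symm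

omit [Finite G] in
theorem x_mul_y (h : IsQuaternionPair D x y) : x * y = y * x⁻¹ := by
  rw [(h.comm x h.x_mem y h.y_mem).resolve_left h.ne, mul_assoc, ← pow_succ']
  congr 1
  rw [eq_inv_iff_mul_eq_one, ← pow_succ, h.pow_four]

omit [Finite G] in
theorem nonempty_mulEquiv (h : IsQuaternionPair D x y) : Nonempty (D ≃* QuaternionGroup 2) := by
  let f := quaternionLift h.pow_four h.y_mul_y h.x_mul_y
  have hinj : Function.Injective f :=
    quaternionLift_injective h.pow_four h.y_mul_y h.x_mul_y h.sq_ne h.ne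
  have hxr : x ∈ f.range := ⟨.a 1, by
    change x ^ (ZMod.val (1 : ZMod 4)) = x
    exact pow_one x⟩
  have hyr : y ∈ f.range := ⟨.xa 0, by
    change y * x ^ (ZMod.val (0 : ZMod 4)) = y
    rw [ZMod.val_zero, pow_zero, mul_one]⟩
  have key : ∀ u ∈ D, u * x = x * u → u ∈ f.range := by
    intro u hu hc
    rcases h.eq_of_commute h.x_mem rfl hu hc with rfl | rfl | rfl | rfl
    · exact f.range.one_mem
    · exact f.range.pow_mem hxr 2
    · exact hxr
    · exact f.range.mul_mem (f.range.pow_mem hxr 2) hxr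
  have hrange : f.range = D := by
    apply le_antisymm
    · rintro _ ⟨(i | i), rfl⟩
      · exact D.pow_mem h.x_mem _
      · exact D.mul_mem h.y_mem (D.pow_mem h.x_mem _)
    · intro u hu
      by_cases hc : u * x = x * u
      · exact key u hu hc
      · have h1 := key _ (D.mul_mem hu (D.inv_mem h.y_mem))
          (h.commute_mul_inv h.x_mem hu h.y_mem hc h.ne.symm)
        simpa using f.range.mul_mem h1 hyr
  exact ⟨((MonoidHom.ofInjective hinj).trans (MulEquiv.subgroupCongr hrange)).symm⟩

/-- If all elements of order `4` are conjugate into `D`, then `D` contains all `2`-elements. -/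
theorem mem_of_pow (h : IsQuaternionPair D x y) (hG : IsApiAt 2 G) (t : G) (k : ℕ)
    (ht : t ^ 2 ^ k = 1) : t ∈ D := by
  have h4 : ∀ u : G, u ^ 4 = 1 → u ∈ D := by
    intro u hu
    obtain ⟨j, hj2, hj⟩ := (Nat.dvd_prime_pow Nat.prime_two).1
      (orderOf_dvd_of_pow_eq_one (show u ^ 2 ^ 2 = 1 by simpa using hu))
    have hxo : orderOf x = 2 ^ 2 :=
      orderOf_eq_prime_pow (by simpa using h.sq_ne) (by simpa using h.pow_four)
    have : orderOf (x ^ 2 ^ (2 - j)) = 2 ^ j := by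
      rw [orderOf_pow_of_dvd (by positivity) (by rw [hxo]; exact pow_dvd_pow _ (by omega)), hxo,
        Nat.pow_div (by omega) (by norm_num)]
      congr 1; omega
    exact hG.mem_normal_of_orderOf_eq h.normal this hj (D.pow_mem h.x_mem _)
  by_contra htD
  obtain ⟨j, hs, hd⟩ := exists_pow_notMem_pow_mem htD ht
  set s := t ^ 2 ^ j
  set d := s ^ 2 with hd'
  have hd2 : d ^ 2 = x ^ 2 := by
    rcases h.sq_eq d hd with h1 | h1 | h1
    · exact absurd (h4 s (by rw [show (4 : ℕ) = 2 * 2 from rfl, pow_mul, ← hd', h1, one_pow])) hs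
    · exact absurd (h4 s (by rw [show (4 : ℕ) = 2 * 2 from rfl, pow_mul, ← hd', h1, h.sq_sq])) hs
    · exact h1
  obtain ⟨v, hv, hvd⟩ : ∃ v ∈ D, v * d ≠ d * v := by
    by_contra! hcon
    have hx := h.eq_of_commute h.x_mem rfl hd (hcon x h.x_mem).symm
    rcases hx with h1 | h1 | h1 | h1
    · rw [h1, one_pow] at hd2
      exact h.sq_ne hd2.symm
    · rw [h1, h.sq_sq] at hd2
      exact h.sq_ne hd2.symm
    · apply h.ne
      rw [← h1, hcon y h.y_mem]
    · apply h.ne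
      have := hcon y h.y_mem
      rw [h1, ← mul_assoc, h.sq_central y h.y_mem, mul_assoc, mul_assoc] at this
      exact (mul_left_cancel this).symm
  set v' := s⁻¹ * v * s with hv'
  have hv'D : v' ∈ D := by simpa using h.normal.conj_mem v hv s⁻¹
  have hsd : s * d = d * s := by rw [hd']; exact ((Commute.refl s).pow_right 2).eq
  have hv'd : v' * d ≠ d * v' := by
    intro hcon
    apply hvd
    have e1 : v = s * v' * s⁻¹ := by rw [hv']; group
    have e2 : d = s * d * s⁻¹ := by rw [hsd]; group
    rw [e1]
    conv_lhs => rw [e2]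
    conv_rhs => rw [e2]
    rw [conj_mul, conj_mul, hcon]
  have hv2 := h.sq_eq_of_ne hv hd hvd
  have hsa : s * x ^ 2 = x ^ 2 * s := by rw [← hd2]; exact ((show Commute s d from hsd).pow_right 2).eq
  have hcase := h.eq_of_commute hd hd2 (D.mul_mem hv'D (D.inv_mem hv))
    (h.commute_mul_inv hd hv'D hv hv'd hvd)
  have hfix : s⁻¹ * v' * s = v → False := by
    intro hcon
    apply hvd
    have e1 : d⁻¹ * v * d = v := by
      conv_rhs => rw [← hcon, hv']
      rw [hd', sq]; group
    rw [mul_assoc, inv_mul_eq_iff_eq_mul] at e1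
    exact e1
  have hsv : (s * v) ^ 2 = d * (v' * v) := by
    rw [hv', hd', sq, sq]; group
  have hnot : ¬ (s * v) ^ 4 = 1 := by
    intro hcon
    have h1 := D.mul_mem (h4 _ hcon) (D.inv_mem hv)
    rw [mul_inv_cancel_right] at h1
    exact hs h1
  rcases hcase with h1 | h1 | h1 | h1
  · have : v' = v := mul_inv_eq_one.1 h1
    exact hfix (by rw [this, ← hv', this])
  · have h2 : v' = x ^ 2 * v := mul_inv_eq_iff_eq_mul.1 h1
    apply hfix
    have : s⁻¹ * x ^ 2 = x ^ 2 * s⁻¹ := ((show Commute s (x ^ 2) from hsa).inv_left).eq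
    rw [h2, ← mul_assoc, this, mul_assoc, mul_assoc, ← mul_assoc s⁻¹, ← hv', h2, ← mul_assoc, ← sq,
      h.sq_sq, one_mul]
  · have h2 : v' = d * v := mul_inv_eq_iff_eq_mul.1 h1
    apply hnot
    rw [show (4 : ℕ) = 2 * 2 from rfl, pow_mul, hsv, h2, mul_assoc, ← sq v, ← mul_assoc, ← sq d, hd2,
      hv2, ← sq, h.sq_sq, one_pow]
  · have h2 : v' = x ^ 2 * d * v := mul_inv_eq_iff_eq_mul.1 h1
    apply hnot
    rw [show (4 : ℕ) = 2 * 2 from rfl, pow_mul, hsv, h2, mul_assoc, ← sq v, hv2, ← mul_assoc,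
      ← mul_assoc, h.sq_central d hd, mul_assoc (x ^ 2), ← sq d, hd2, ← sq, h.sq_sq, one_mul, h.sq_sq]

end IsQuaternionPair

/-- A maximal normal cyclic `p`-subgroup `A` above `E` contains every solution of `x ^ |A| = 1`.
Hence `x ∉ A` with `x ^ p ∈ A` has `x ^ p` generating `A`, and so centralizes `A`. If `A` is
self-centralizing in `T`, no such `x` exists and `A` is Sylow. Otherwise a normal `D` with `D / A`
elementary and central in `C / A`, where `C` is the centralizer of `A` in `T`, turns out to be
quaternion. -/
theorem IsApiAt.exists_cyclic_or_quaternion (hG : IsApiAt p G) (hTn : T.Normal)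
    (hTp : IsPGroup p T) (hTc : Subgroup.centralizer (T : Set G) ≤ T)
    (hTmax : ∀ M : Subgroup G, M.Normal → IsPGroup p M → M ≤ T) {E : Subgroup G} (hE : E.Normal)
    (hEp : Nat.card E = p) :
    ∃ S : Subgroup G, IsNormalSylowSelfCentralizing p S ∧
      (IsCyclic S ∨ (p = 2 ∧ Nonempty (S ≃* QuaternionGroup 2))) := by
  obtain ⟨A, ⟨⟨hAn, hAc, hAp⟩, hEA⟩, hAmax⟩ : ∃ A : Subgroup G,
      ((A.Normal ∧ IsCyclic A ∧ IsPGroup p A) ∧ E ≤ A) ∧ ∀ B : Subgroup G,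
      (B.Normal ∧ IsCyclic B ∧ IsPGroup p B) → A ≤ B → B ≤ A := by
    obtain ⟨A, hEA, hA⟩ := (Set.toFinite {A : Subgroup G | A.Normal ∧ IsCyclic A ∧
      IsPGroup p A}).exists_le_maximal (a := E)
      ⟨hE, isCyclic_of_prime_card hEp, IsPGroup.of_card (n := 1) (by simpa using hEp)⟩
    exact ⟨A, ⟨hA.1, hEA⟩, fun B hB hAB => hA.2 hB hAB⟩
  have hAT : A ≤ T := hTmax A hAn hAp
  obtain ⟨m, hm⟩ := IsPGroup.iff_card.1 hAp
  have hm1 : 1 ≤ m := by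
    by_contra! h0
    obtain rfl : m = 0 := by omega
    have := Subgroup.card_le_of_le hEA
    rw [hm, hEp] at this
    have := hp.out.two_le
    simp at *
    omega
  have hAmem : ∀ x : G, x ^ p ^ m = 1 → x ∈ A := fun x hx => hG.mem_of_pow_eq_one hAn hAc hm hx
  have hAmem1 : ∀ x : G, x ^ p = 1 → x ∈ A := fun x hx => hAmem x (by
    obtain ⟨k, rfl⟩ : ∃ k, m = k + 1 := ⟨m - 1, by omega⟩
    rw [pow_succ', pow_mul, hx, one_pow])
  have hgen : ∀ x : G, x ∉ A → x ^ p ∈ A → Subgroup.zpowers (x ^ p) = A := by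
    intro x hx hxp
    apply Subgroup.eq_of_le_of_card_ge (Subgroup.zpowers_le.2 hxp)
    rw [Nat.card_zpowers, hm]
    obtain ⟨j, hjm, hj⟩ := (Nat.dvd_prime_pow hp.out).1 (show orderOf (x ^ p) ∣ p ^ m by
      rw [← hm]; exact Subgroup.orderOf_dvd_natCard A hxp)
    rw [hj]
    apply Nat.pow_le_pow_right hp.out.pos
    by_contra! hlt
    apply hx
    apply hAmem
    obtain ⟨k, rfl⟩ : ∃ k, m = k + 1 := ⟨m - 1, by omega⟩
    rw [pow_succ', pow_mul]
    apply orderOf_dvd_iff_pow_eq_one.1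
    rw [hj]
    exact pow_dvd_pow _ (by omega)
  have hcomm : ∀ x : G, x ∉ A → x ^ p ∈ A → x ∈ Subgroup.centralizer (A : Set G) := by
    intro x hx hxp a ha
    rw [SetLike.mem_coe, ← hgen x hx hxp] at ha
    obtain ⟨i, rfl⟩ := ha
    exact (((Commute.refl x).pow_left p).zpow_left i).eq
  by_cases hC : T ⊓ Subgroup.centralizer (A : Set G) ≤ A
  · refine ⟨A, isNormalSylowSelfCentralizing_of_le hAn hAp hTp hTc hTmax ?_, Or.inl hAc⟩
    have hTA : T = A := by
      refine le_antisymm (fun t ht => ?_) hAT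
      by_contra htA
      obtain ⟨k, hk⟩ := hTp ⟨t, ht⟩
      obtain ⟨j, hj1, hj2⟩ := exists_pow_notMem_pow_mem htA (congrArg Subtype.val hk)
      exact hj1 (hC ⟨T.pow_mem ht _, hcomm _ hj1 hj2⟩)
    intro x k hx
    by_contra hxA
    obtain ⟨j, hj1, hj2⟩ := exists_pow_notMem_pow_mem hxA hx
    have := hcomm _ hj1 hj2
    rw [← hTA] at this hj1
    exact hj1 (hTc this)
  set C := T ⊓ Subgroup.centralizer (A : Set G) with hCdef
  have hAab : ∀ a ∈ A, ∀ b ∈ A, a * b = b * a := by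
    intro a ha b hb
    have := hAc.commGroup.mul_comm ⟨a, ha⟩ ⟨b, hb⟩
    exact congrArg Subtype.val this
  have hAC : A ≤ C := le_inf hAT fun a ha b hb => hAab b hb a ha
  have hCn : C.Normal := inferInstance
  obtain ⟨E', hE'n, hE'0, hE'C, hE'c, hE'p⟩ := exists_normal_elementary (p := p)
    (N := C.map (QuotientGroup.mk' A)) (hCn.map _ (QuotientGroup.mk'_surjective A))
    ((hTp.to_le inf_le_left).map _) (by
      intro h
      rw [Subgroup.map_eq_bot_iff, QuotientGroup.ker_mk'] at h
      exact hC h)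
  set D := E'.comap (QuotientGroup.mk' A) with hD
  have hDn : D.Normal := inferInstance
  have hDC : D ≤ C := by
    intro x hx
    obtain ⟨c, hc, hcx⟩ := hE'C hx
    have h1 : c⁻¹ * x ∈ A := QuotientGroup.eq.1 hcx
    simpa using C.mul_mem hc (hAC h1)
  have hAD : A ≤ D := by
    intro a ha
    change QuotientGroup.mk' A a ∈ E'
    rw [(QuotientGroup.eq_one_iff a).2 ha |> fun h => (h : QuotientGroup.mk' A a = 1)]
    exact E'.one_mem
  have hDp : ∀ x ∈ D, x ^ p ∈ A := by
    intro x hx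
    rw [← QuotientGroup.eq_one_iff]
    exact hE'p _ hx
  have hDA : ∀ x ∈ D, ∀ a ∈ A, a * x = x * a := fun x hx a ha => (hDC hx).2 a ha
  have hDcomm : ∀ x ∈ D, ∀ y ∈ D, ∃ c ∈ A, x * y = y * x * c := by
    intro x hx y hy
    refine ⟨(y * x)⁻¹ * (x * y), ?_, by group⟩
    rw [← QuotientGroup.eq]
    exact (hE'c _ hx _ (hE'C hy)).symm
  obtain ⟨x, hxD, hxA⟩ : ∃ x ∈ D, x ∉ A := by
    obtain ⟨⟨e, he⟩, he1⟩ := E'.ne_bot_iff_exists_ne_one.1 hE'0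
    obtain ⟨x, rfl⟩ := QuotientGroup.mk'_surjective A e
    exact ⟨x, he, fun hx => he1 (Subtype.ext ((QuotientGroup.eq_one_iff x).2 hx))⟩
  have hzp : ∀ x ∈ D, x ∉ A → ∀ y ∈ D, ∃ i : ℤ, y ^ p = (x ^ p) ^ i := by
    intro x hx hxA y hy
    have := hDp y hy
    rw [← hgen x hxA (hDp x hx)] at this
    obtain ⟨i, hi⟩ := this
    exact ⟨i, hi.symm⟩
  -- An abelian `D` would be cyclic, against maximality of `A`: correcting `y` by a power of `x`
  -- gives an element of order dividing `p`, which lies in `A`, the group generated by `x ^ p`.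
  obtain ⟨x, hxD, y, hyD, hxy⟩ : ∃ x ∈ D, ∃ y ∈ D, x * y ≠ y * x := by
    by_contra! hab
    have hcyc : IsCyclic D := by
      refine ⟨⟨x, hxD⟩, fun ⟨y, hy⟩ => ?_⟩
      obtain ⟨i, hi⟩ := hzp x hxD hxA y hy
      have h1 : y * x ^ (-i) ∈ A := by
        apply hAmem1
        have hc : Commute y (x ^ (-i)) := (show Commute y x from hab y hy x hxD).zpow_right _
        rw [hc.mul_pow, hi, ← zpow_natCast, ← zpow_natCast, ← zpow_mul, ← zpow_mul, ← zpow_add]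
        convert zpow_zero x using 2
        ring
      rw [← hgen x hxA (hDp x hxD)] at h1
      obtain ⟨j, hj⟩ := h1
      refine ⟨p * j + i, Subtype.ext ?_⟩
      change x ^ (p * j + i) = y
      have hj' : (x ^ p) ^ j = y * x ^ (-i) := hj
      rw [zpow_add, zpow_mul, zpow_natCast, hj', zpow_neg, inv_mul_cancel_right]
    exact hxA (hAmax D ⟨hDn, hcyc, hTp.to_le (hDC.trans inf_le_left)⟩ hAD hxD)
  have hnA : ∀ u ∈ D, ∀ v ∈ D, u * v ≠ v * u → u ∉ A := fun u hu v hv hne huA =>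
    hne (hDA v hv u huA)
  have hxA := hnA x hxD y hyD hxy
  have hyA := hnA y hyD x hxD hxy.symm
  obtain ⟨i, hi⟩ := hzp x hxD hxA y hyD
  -- Chosen so that `y ^ p * w ^ p = 1`. Then `(y * w) ^ p = c ^ p.choose 2` with `c ^ p = 1`, while
  -- `y * w ∉ A`. For odd `p` this power is 1, a contradiction; for `p = 2` the fourth power is 1,
  -- which is contradictory unless `|A| = 2`.
  set w := x ^ (-i) with hw
  have hwD : w ∈ D := D.zpow_mem hxD _
  obtain ⟨c, hcA, hc⟩ := hDcomm w hwD y hyD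
  have hcw : Commute c w := hDA w hwD c hcA
  have hcy : Commute c y := hDA y hyD c hcA
  have hwp : y ^ p * w ^ p = 1 := by
    rw [hi, hw, ← zpow_natCast, ← zpow_natCast, ← zpow_mul, ← zpow_mul, ← zpow_add]
    convert zpow_zero x using 2
    ring
  have hzA : y * w ∉ A := by
    intro hz
    apply hxy
    have h1 := hDA x hxD _ hz
    have h2 : w * x = x * w := ((Commute.refl x).zpow_left _).eq
    rw [mul_assoc, h2, ← mul_assoc, ← mul_assoc] at h1
    exact (mul_right_cancel h1).symm
  have hcp : c ^ p = 1 := by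
    have h3 := pow_mul_of_commutator hc hcw p
    rw [hDA y hyD _ (hDp w hwD)] at h3
    exact (mul_eq_left.1 h3.symm)
  have hzpow : (y * w) ^ p = c ^ p.choose 2 := by
    rw [mul_pow_of_commutator hc hcw hcy, hwp, one_mul]
  have hp2 : p = 2 := by
    by_contra hp2
    apply hzA
    apply hAmem1
    have : p ∣ p.choose 2 := hp.out.dvd_choose_self two_ne_zero
      (lt_of_le_of_ne hp.out.two_le (Ne.symm hp2))
    obtain ⟨k, hk⟩ := this
    rw [hzpow, hk, pow_mul, hcp, one_pow]
  subst hp2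
  have hm' : m = 1 := by
    by_contra hm'
    apply hzA
    apply hAmem
    obtain ⟨k, rfl⟩ : ∃ k, m = k + 2 := ⟨m - 2, by omega⟩
    rw [pow_add, mul_comm, pow_mul, show 2 ^ 2 = 2 * 2 from rfl, pow_mul (y * w), hzpow,
      Nat.choose_self, pow_one, hcp, one_pow]
  subst hm'
  have hx2A := hDp x hxD
  have hx2 : x ^ 2 ≠ 1 := fun h => hxA (hAmem1 x h)
  have hA2 : ∀ a ∈ A, a = 1 ∨ a = x ^ 2 := by
    intro a ha
    rw [← hgen x hxA hx2A] at ha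
    obtain ⟨i, rfl⟩ := ha
    have h4 : (x ^ 2) ^ 2 = 1 := by
      have := pow_card_eq_one' (G := A) (x := ⟨x ^ 2, hx2A⟩)
      rw [hm] at this
      simpa using congrArg Subtype.val this
    rcases Int.even_or_odd' i with ⟨k, rfl | rfl⟩
    · left
      change (x ^ 2) ^ (2 * k) = 1
      rw [zpow_mul, zpow_ofNat, h4, one_zpow]
    · right
      change (x ^ 2) ^ (2 * k + 1) = x ^ 2
      rw [zpow_add, zpow_mul, zpow_ofNat, h4, one_zpow, one_mul, zpow_one]
  have hpair : IsQuaternionPair D x y :=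
    { normal := hDn
      x_mem := hxD
      y_mem := hyD
      sq_ne := hx2
      ne := hxy
      sq_central := fun u hu => (hDA u hu _ hx2A).symm
      sq_sq := by
        have := pow_card_eq_one' (G := A) (x := ⟨x ^ 2, hx2A⟩)
        rw [hm] at this
        simpa using congrArg Subtype.val this
      sq_eq := fun u hu => by
        by_cases huA : u ∈ A
        · rcases hA2 u huA with h | h
          · exact Or.inl h
          · exact Or.inr (Or.inl h)
        · exact Or.inr (Or.inr ((hA2 _ (hDp u hu)).resolve_left fun h => huA (hAmem1 u h)))
      comm := fun u hu v hv => by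
        obtain ⟨c, hc, h⟩ := hDcomm u hu v hv
        rcases hA2 c hc with rfl | rfl
        · left; rw [h, mul_one]
        · exact Or.inr h }
  exact ⟨D, isNormalSylowSelfCentralizing_of_le hDn (hTp.to_le (hDC.trans inf_le_left)) hTp hTc
    hTmax (hpair.mem_of_pow hG), Or.inr ⟨rfl, hpair.nonempty_mulEquiv⟩⟩

theorem IsApiAt.exists_normal_sylow (hG : IsApiAt p G) (hs : Group.IsSolvable G)
    (hcore : ∀ M : Subgroup G, M.Normal → (Nat.card M).Coprime p → M = ⊥)
    (hpG : p ∣ Nat.card G) :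
    ∃ S : Subgroup G, IsNormalSylowSelfCentralizing p S ∧
      (IsCyclic S ∨ (p = 2 ∧ Nonempty (S ≃* QuaternionGroup 2)) ∨
        ((∀ x ∈ S, ∀ y ∈ S, x * y = y * x) ∧ ∀ x ∈ S, x ^ p = 1)) := by
  obtain ⟨T, hTn, hTp, hTc, hTmax⟩ := exists_normal_pGroup_centralizer_le hs hcore
  have hT0 : T ≠ ⊥ := by
    rintro rfl
    have h1 : (⊤ : Subgroup G) ≤ ⊥ := le_trans (fun g _ => by
      rintro x rfl; rw [one_mul, mul_one]) hTc
    have h2 := Subgroup.card_eq_one.2 (le_bot_iff.1 h1)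
    rw [Subgroup.card_top] at h2
    rw [h2] at hpG
    exact hp.out.one_lt.ne' (Nat.dvd_one.1 hpG)
  by_cases hno : ∃ g : G, orderOf g = p ^ 2
  · obtain ⟨g, hg⟩ := hno
    obtain ⟨E, hE, hEp⟩ := hG.exists_normal_card_eq_prime hTn hTp hT0 hg
    obtain ⟨S, hS, h⟩ := hG.exists_cyclic_or_quaternion hTn hTp hTc hTmax hE hEp
    exact ⟨S, hS, h.imp_right Or.inl⟩
  · push Not at hno
    obtain ⟨S, hS, h⟩ := hG.exists_elementary hTn hTp hTc hTmax hT0 hno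
    exact ⟨S, hS, Or.inr (Or.inr h)⟩

end CyclicNormal

/-- The linear form of an action by automorphisms on a commutative group of exponent `p`. -/
def zmodLinearAction {G S : Type*} [Group G] [CommGroup S] {p : ℕ} [Module (ZMod p) (Additive S)]
    (f : G →* MulAut S) : G →* (Additive S ≃ₗ[ZMod p] Additive S) where
  toFun g := (MulEquiv.toAdditive (f g)).toLinearEquiv
    (fun c x => ZMod.map_smul (MulEquiv.toAdditive (f g)) c x)
  map_one' := by
    refine LinearEquiv.ext fun v => ?_
    change Additive.ofMul (f 1 v.toMul) = v
    rw [map_one]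
    rfl
  map_mul' g h := by
    refine LinearEquiv.ext fun v => ?_
    change Additive.ofMul (f (g * h) v.toMul) = Additive.ofMul (f g (f h v.toMul))
    rw [map_mul]
    rfl

/-! ### The linear action on an elementary abelian Sylow subgroup -/

section ElementaryRepresentation

universe u

variable {G : Type u} [Group G] [Finite G] {p : ℕ} [hp : Fact p.Prime]

/-- The conjugation action on a normal elementary abelian subgroup, written linearly. -/
theorem exists_linear_conj (S : Subgroup G) [hS : S.Normal]
    (hcomm : ∀ x ∈ S, ∀ y ∈ S, x * y = y * x) (hexp : ∀ x ∈ S, x ^ p = 1) :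
    ∃ (V : Type u) (_ : AddCommGroup V) (_ : Module (ZMod p) V) (_ : Finite V)
      (e : S ≃* Multiplicative V) (ρ : G →* (V ≃ₗ[ZMod p] V)),
      ∀ g s, ρ g (e s).toAdd = (e (MulAut.conjNormal g s)).toAdd := by
  let _ : CommGroup S := { (inferInstance : Group S) with
    mul_comm := fun x y => Subtype.ext (hcomm x x.2 y y.2) }
  let _ : Module (ZMod p) (Additive S) := AddCommGroup.zmodModule (fun x =>
    congrArg Additive.ofMul (show x.toMul ^ p = 1 from Subtype.ext (hexp _ x.toMul.2)))
  have _ : Finite (Additive S) := inferInstanceAs (Finite S)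
  exact ⟨Additive S, inferInstance, inferInstance, inferInstance, MulEquiv.refl S,
    zmodLinearAction MulAut.conjNormal, fun g s => rfl⟩

/-- The structure of a normal elementary abelian subgroup `S` of rank `n ≥ 2` all of whose
subgroups of equal order are conjugate. -/
theorem IsApiAt.elementary_structure (hG : IsApiAt p G) (hs : Group.IsSolvable G) {S : Subgroup G}
    (hS : IsNormalSylowSelfCentralizing p S) (hcomm : ∀ x ∈ S, ∀ y ∈ S, x * y = y * x)
    (hexp : ∀ x ∈ S, x ^ p = 1) (hnc : ¬ IsCyclic S) :
    ∃ n : ℕ, Nonempty (S ≃* ElemAbGrp p n) ∧ (n = 2 ∨ n = 3 ∨ (n = 5 ∧ p = 2)) ∧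
      (p = 2 → S.index ∣ n * (2 ^ n - 1) ∧ 2 ^ n - 1 ∣ S.index ∧ (n = 5 → 155 ∣ S.index)) := by
  have hSn := hS.normal
  obtain ⟨V, _, _, _, e, ρ, hρ⟩ := exists_linear_conj S hcomm hexp
  have hF : Nat.card (ZMod p) = p := Nat.card_zmod p
  set n := finrank (ZMod p) V with hn
  have hcardS : Nat.card S = p ^ n := by
    have h := card_eq_card_field_pow (F := ZMod p) (V := V)
    rw [hF] at h
    exact (Nat.card_congr e.toEquiv).trans h
  have hn2 : 2 ≤ n := by
    by_contra! hlt
    apply hnc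
    obtain h0 | h1 : n = 0 ∨ n = 1 := by omega
    · rw [h0, pow_zero] at hcardS
      have := (Nat.card_eq_one_iff_unique.1 hcardS).1
      exact isCyclic_of_subsingleton
    · rw [h1, pow_one] at hcardS
      exact isCyclic_of_prime_card hcardS
  have hnt : Nontrivial V := Module.nontrivial_of_finrank_pos (R := ZMod p) (by omega)
  -- the subgroup of `G` corresponding to a subspace
  let K : Submodule (ZMod p) V → Subgroup G := fun U =>
    (U.toAddSubgroup.toSubgroup.comap e.toMonoidHom).map S.subtype
  have hKmem : ∀ U (s : S), s.1 ∈ K U ↔ (e s).toAdd ∈ U := by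
    intro U s
    constructor
    · rintro ⟨t, ht, hts⟩
      obtain rfl : t = s := Subtype.ext hts
      exact ht
    · intro h
      exact ⟨s, h, rfl⟩
  have hKS : ∀ U, K U ≤ S := by
    rintro U _ ⟨s, -, rfl⟩
    exact s.2
  have hKcard : ∀ U, Nat.card (K U) = p ^ finrank (ZMod p) U := by
    intro U
    have h := card_eq_card_field_pow (F := ZMod p) (V := U)
    rw [hF] at h
    rw [← h, Subgroup.card_map_of_injective S.subtype_injective]
    exact Nat.card_congr ⟨fun s => ⟨(e s.1).toAdd, s.2⟩,
      fun v => ⟨e.symm (Multiplicative.ofAdd v.1), by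
        change (e (e.symm (Multiplicative.ofAdd v.1))).toAdd ∈ U
        rw [MulEquiv.apply_symm_apply]
        exact v.2⟩, fun s => Subtype.ext (e.symm_apply_apply s.1), fun v => by simp⟩
  have hKcomm : ∀ U, IsMulCommutative (K U) := fun U =>
    ⟨⟨fun x y => Subtype.ext (hcomm _ (hKS U x.2) _ (hKS U y.2))⟩⟩
  -- Subspaces of equal dimension are abelian subgroups of equal order, so a conjugating element
  -- carries one to the other.
  have htrans : ∀ U W : Submodule (ZMod p) V, finrank (ZMod p) U = finrank (ZMod p) W →
      ∃ g, U.map (ρ g : V →ₗ[ZMod p] V) = W := by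
    intro U W hUW
    obtain ⟨g, hg⟩ := hG _ (K U) (K W) (hKcomm U) (hKcomm W) (hKcard U)
      (by rw [hKcard, hUW])
    refine ⟨g, Submodule.eq_of_le_of_finrank_eq ?_ ?_⟩
    · rintro _ ⟨v, hv, rfl⟩
      obtain ⟨s, rfl⟩ : ∃ s, (e s).toAdd = v := ⟨e.symm (Multiplicative.ofAdd v), by simp⟩
      rw [LinearEquiv.coe_coe, hρ, ← hKmem, ← hg]
      exact ⟨s.1, (hKmem U s).2 hv, rfl⟩
    · rw [← hUW]
      exact LinearEquiv.finrank_map_eq (ρ g) U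
  have hplane : ∀ U W : Submodule (ZMod p) V, finrank (ZMod p) U = 2 → finrank (ZMod p) W = 2 →
      ∃ g, U.map (ρ g : V →ₗ[ZMod p] V) = W := fun U W hU hW => htrans U W (hU.trans hW.symm)
  have hline : ∀ v w : V, v ≠ 0 → w ≠ 0 → ∃ g, ∃ c : (ZMod p)ˣ, c • ρ g v = w := by
    intro v w hv hw
    obtain ⟨g, hg⟩ := htrans (Submodule.span (ZMod p) {v}) (Submodule.span (ZMod p) {w})
      (by rw [finrank_span_singleton hv, finrank_span_singleton hw])
    have h1 : w ∈ (Submodule.span (ZMod p) {v}).map (ρ g : V →ₗ[ZMod p] V) :=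
      hg ▸ Submodule.mem_span_singleton_self w
    obtain ⟨u, hu, huw⟩ := h1
    obtain ⟨c, rfl⟩ := Submodule.mem_span_singleton.1 hu
    rw [map_smul] at huw
    have hc : c ≠ 0 := by
      rintro rfl
      rw [zero_smul] at huw
      exact hw huw.symm
    exact ⟨g, Units.mk0 c hc, huw⟩
  -- The kernel is the centralizer of `S`, and `S` is abelian and self-centralizing; thus the image
  -- of `ρ` has order `S.index`.
  have hker : ρ.ker = S := by
    ext g
    have h1 : g ∈ ρ.ker ↔ ∀ s : S, g * s.1 * g⁻¹ = s.1 := by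
      rw [MonoidHom.mem_ker]
      constructor
      · intro h s
        have h2 := hρ g s
        rw [h] at h2
        have h3 : e s = e (MulAut.conjNormal g s) := h2
        have := congrArg Subtype.val (e.injective h3)
        rw [MulAut.conjNormal_apply] at this
        exact this.symm
      · intro h
        ext v
        obtain ⟨s, rfl⟩ : ∃ s, (e s).toAdd = v := ⟨e.symm (Multiplicative.ofAdd v), by simp⟩
        have h2 : MulAut.conjNormal g s = s := Subtype.ext (by
          rw [MulAut.conjNormal_apply]; exact h s)
        rw [hρ, h2]
        rfl
    rw [h1]
    constructor
    · intro h
      apply hS.centralizer_le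
      intro s hs
      exact (mul_inv_eq_iff_eq_mul.1 (h ⟨s, hs⟩)).symm
    · intro hg s
      rw [hcomm g hg s.1 s.2, mul_inv_cancel_right]
  have hindex : Nat.card ρ.range = S.index := by
    rw [← hker, Subgroup.index, Nat.card_congr (QuotientGroup.quotientKerEquivRange ρ).toEquiv]
  have hfp : (Nat.card (ZMod p)).Prime := hF.symm ▸ hp.out
  refine ⟨n, ⟨e.trans (AddEquiv.toMultiplicative
    (finBasisOfFinrankEq (ZMod p) V rfl).equivFun.toAddEquiv)⟩, ?_, ?_⟩
  · by_cases h4 : 4 ≤ n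
    · have := finrank_eq_five_of_transitive hs ρ hfp h4 hline hplane
      rw [hF] at this
      exact Or.inr (Or.inr this)
    · omega
  · intro hp2
    have := card_range_of_transitive hs ρ (hF.trans hp2) hn2 hline hplane
    rwa [hindex] at this

end ElementaryRepresentation

/-! ### Complements and faithful semidirect products -/

section Complements

variable {G : Type*} [Group G]

theorem isFaithfulSemidirect_of_isComplement' {S H : Subgroup G} (hSn : S.Normal)
    (hSH : S.IsComplement' H) (hc : Subgroup.centralizer (S : Set G) ≤ S)
    {N K : Type*} [Group N] [Group K] (e : S ≃* N) (f : H ≃* K) : IsFaithfulSemidirect G N K := by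
  set φ : H →* MulAut S :=
    S.normalizerMonoidHom.comp (Subgroup.inclusion (S.normalizer_eq_top ▸ le_top)) with hφ
  have hinj : Function.Injective φ := by
    rw [injective_iff_map_eq_one]
    intro h hh
    have h1 : h.1 ∈ S := by
      apply hc
      intro s hs
      have h2 : h.1 * s * h.1⁻¹ = s :=
        congrArg Subtype.val (DFunLike.congr_fun hh (⟨s, hs⟩ : S))
      exact (mul_inv_eq_iff_eq_mul.1 h2).symm
    exact Subtype.ext (Subgroup.disjoint_def.1 hSH.disjoint h1 h.2)
  exact ⟨(MulAut.congr e : MulAut S →* MulAut N).comp (φ.comp f.symm),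
    (MulAut.congr e).injective.comp (hinj.comp f.symm.injective),
    ⟨(SemidirectProduct.mulEquivSubgroup hSH).symm.trans (SemidirectProduct.congr' e f)⟩⟩

theorem card_cyclicGrp (n : ℕ) : Nat.card (CyclicGrp n) = n := Nat.card_zmod n

/-- A group of order `q * r` without central elements of order `r` is a Frobenius group. -/
theorem isFaithfulSemidirect_of_card_eq_mul [Finite G] {q r : ℕ} (hq : q.Prime) (hr : r.Prime)
    (hrq : r < q) (hcard : Nat.card G = q * r)
    (hcenter : ∀ h ∈ Subgroup.center G, orderOf h ≠ r) :
    IsFaithfulSemidirect G (CyclicGrp q) (CyclicGrp r) := by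
  have : Fact q.Prime := ⟨hq⟩
  have : Fact r.Prime := ⟨hr⟩
  obtain ⟨P, hP⟩ := Sylow.exists_subgroup_card_pow_prime (G := G) q (n := 1)
    (by rw [hcard, pow_one]; exact dvd_mul_right _ _)
  rw [pow_one] at hP
  have hindex : P.index = r := by
    have := P.card_mul_index
    rw [hP, hcard] at this
    exact Nat.eq_of_mul_eq_mul_left hq.pos this
  have hmin : (Nat.card G).minFac = r := by
    apply le_antisymm
    · exact Nat.minFac_le_of_dvd hr.two_le (hcard ▸ dvd_mul_left _ _)
    · have h1 : (Nat.card G).minFac.Prime := Nat.minFac_prime (by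
        rw [hcard]; exact (one_lt_mul'' hq.one_lt hr.one_lt).ne')
      have h2 := Nat.minFac_dvd (Nat.card G)
      rw [hcard] at h1 h2
      rw [hcard]
      rcases h1.dvd_mul.1 h2 with h | h
      · rw [(Nat.prime_dvd_prime_iff_eq h1 hq).1 h]
        exact hrq.le
      · rw [(Nat.prime_dvd_prime_iff_eq h1 hr).1 h]
  have hPn : P.Normal := Subgroup.normal_of_index_eq_minFac_card (hindex.trans hmin.symm)
  have hqr : q.Coprime r := (Nat.coprime_primes hq hr).2 hrq.ne'
  obtain ⟨L, hL⟩ := Subgroup.exists_right_complement'_of_coprime (N := P) (by rwa [hP, hindex])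
  have hLcard : Nat.card L = r := by
    have := hL.card_mul_card
    rw [hP, hcard] at this
    exact Nat.eq_of_mul_eq_mul_left hq.pos this
  have hPC : P ≤ Subgroup.centralizer (P : Set G) := by
    have := isCyclic_of_prime_card hP
    intro x hx y hy
    exact congrArg Subtype.val ((IsCyclic.isMulCommutative (α := P)).is_comm.comm ⟨y, hy⟩ ⟨x, hx⟩)
  refine isFaithfulSemidirect_of_isComplement' hPn hL ?_
    (mulEquivOfPrimeCardEq hP (card_cyclicGrp q)) (mulEquivOfPrimeCardEq hLcard (card_cyclicGrp r))
  -- The order of the centralizer of `P` is then `q * r`, so `P` is central. An element of order `r`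
  -- commutes with `P` and with itself, hence is central, contrary to hypothesis.
  by_contra hle
  obtain ⟨h, hh⟩ := exists_prime_orderOf_dvd_card' (G := G) r (hcard ▸ dvd_mul_left _ _)
  obtain ⟨k, hk⟩ := hP ▸ Subgroup.card_dvd_of_le hPC
  have hkr : k ∣ r := by
    have := Subgroup.card_subgroup_dvd_card (Subgroup.centralizer (P : Set G))
    rw [hk, hcard] at this
    exact Nat.dvd_of_mul_dvd_mul_left hq.pos this
  rcases (Nat.dvd_prime hr).1 hkr with rfl | rfl
  · apply hle
    exact (Subgroup.eq_of_le_of_card_ge hPC (by rw [hk, hP, mul_one])).ge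
  · have hCtop : Subgroup.centralizer (P : Set G) = ⊤ :=
      Subgroup.eq_top_of_card_eq _ (hk.trans hcard.symm)
    refine hcenter h ?_ hh
    have h1 : P ≤ Subgroup.centralizer {h} := by
      intro x hx y hy
      obtain rfl : y = h := hy
      exact ((hCtop ▸ Subgroup.mem_top y : y ∈ Subgroup.centralizer (P : Set G)) x hx).symm
    have h2 : Subgroup.zpowers h ≤ Subgroup.centralizer {h} := by
      rw [Subgroup.zpowers_le]
      rintro y rfl
      rfl
    have h3 : Subgroup.centralizer {h} = ⊤ := by
      apply Subgroup.eq_top_of_le_card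
      rw [hcard]
      refine Nat.le_of_dvd Nat.card_pos (hqr.mul_dvd_of_dvd_of_dvd ?_ ?_)
      · exact hP ▸ Subgroup.card_dvd_of_le h1
      · have := Subgroup.card_dvd_of_le h2
        rwa [Nat.card_zpowers, hh] at this
    rw [Subgroup.mem_center_iff]
    intro g
    exact ((h3 ▸ Subgroup.mem_top g : g ∈ Subgroup.centralizer {h}) h rfl).symm

end Complements

/-! ### Odd-order automorphism groups of the quaternion group -/

section QuaternionAutomorphisms

theorem card_quaternion_sq_ne_one : Nat.card {u : QuaternionGroup 2 // u ^ 2 ≠ 1} = 6 := by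
  rw [Nat.card_eq_fintype_card]
  decide

set_option maxRecDepth 10000 in
theorem quaternion_cases : ∀ u v w : QuaternionGroup 2, u ^ 2 ≠ 1 →
    (∃ i : Fin 4, v = u ^ (i : ℕ)) ∨ (∃ i : Fin 4, w = u ^ (i : ℕ)) ∨
      ∃ i : Fin 4, w = u ^ (i : ℕ) * v := by
  decide

theorem quaternion_pow_four : ∀ u : QuaternionGroup 2, u ^ 4 = 1 := by
  decide

/-- An automorphism of the quaternion group fixing an element of order `4` has order dividing
`4`. -/
theorem quaternion_mulAut_pow_four {θ : MulAut (QuaternionGroup 2)} {u : QuaternionGroup 2}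
    (hu : u ^ 2 ≠ 1) (hθ : θ u = u) : θ ^ 4 = 1 := by
  ext w
  change θ (θ (θ (θ w))) = w
  rcases quaternion_cases u w (θ w) hu with ⟨i, hi⟩ | ⟨i, hi⟩ | ⟨i, hi⟩
  · rw [hi]
    simp only [map_pow, hθ]
  · have h1 : θ w = w := θ.injective (by rw [hi, map_pow, hθ])
    simp only [h1]
  · rw [hi]
    simp only [map_mul, map_pow, hθ, hi]
    simp only [← mul_assoc]
    rw [← pow_add, ← pow_add, ← pow_add, show (i : ℕ) + i + i + i = 4 * i by ring, pow_mul,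
      quaternion_pow_four, one_pow, one_mul]

/-- An automorphism fixing an element of order 4 has order dividing 4, so a group of odd order acts
freely on the six elements of order 4. -/
theorem card_dvd_three_of_odd {H : Type*} [Group H] [Finite H]
    (f : H →* MulAut (QuaternionGroup 2)) (hf : Function.Injective f) (hH : Odd (Nat.card H)) :
    Nat.card H ∣ 3 := by
  let _ : MulAction H {u : QuaternionGroup 2 // u ^ 2 ≠ 1} :=
    { smul := fun h u => ⟨f h u.1, fun hu => u.2 ((f h).injective (by rw [map_pow, hu, map_one]))⟩
      one_smul := fun u => Subtype.ext (by
        change f 1 u.1 = u.1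
        rw [map_one]
        rfl)
      mul_smul := fun g h u => Subtype.ext (by
        change f (g * h) u.1 = f g (f h u.1)
        rw [map_mul]
        rfl) }
  have h6 : Nat.card H ∣ 6 := by
    rw [← card_quaternion_sq_ne_one]
    apply card_dvd_card_of_free_action
    intro h u hu
    have h1 : h ^ 4 = 1 := hf (by
      rw [map_pow, map_one]
      exact quaternion_mulAut_pow_four u.2 (congrArg Subtype.val hu))
    rw [← orderOf_eq_one_iff]
    exact Nat.Coprime.eq_one_of_dvd
      (Nat.Coprime.coprime_dvd_left (orderOf_dvd_natCard h)
        (Nat.Coprime.pow_right 2 (Nat.coprime_two_right.2 hH)))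
      (orderOf_dvd_of_pow_eq_one (n := 2 ^ 2) h1)
  exact (Nat.coprime_two_right.2 hH).dvd_of_dvd_mul_left (n := 3) h6

end QuaternionAutomorphisms

/-! ### Assembling the quotient from its Sylow subgroup and a complement -/

section Structure

set_option linter.unusedSectionVars false

variable {G : Type*} [Group G] [Finite G] {p : ℕ} [hp : Fact p.Prime]

theorem IsNormalSylowSelfCentralizing.eq_sylow {S : Subgroup G}
    (hS : IsNormalSylowSelfCentralizing p S) (Q : Sylow p G) : (Q : Subgroup G) = S := by
  refine (Q.3 hS.isPGroup ?_).symm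
  intro x hx
  obtain ⟨k, hk⟩ := Q.2 ⟨x, hx⟩
  exact hS.mem_of_pow x k (congrArg Subtype.val hk)

theorem IsNormalSylowSelfCentralizing.coprime_index {S : Subgroup G}
    (hS : IsNormalSylowSelfCentralizing p S) : (Nat.card S).Coprime S.index := by
  obtain ⟨Q⟩ := (inferInstance : Nonempty (Sylow p G))
  rw [← hS.eq_sylow Q]
  exact Q.card_coprime_index

theorem IsNormalSylowSelfCentralizing.card_eq {S : Subgroup G}
    (hS : IsNormalSylowSelfCentralizing p S) (hpG : p ∣ Nat.card G) :
    ∃ a : ℕ, 1 ≤ a ∧ Nat.card S = p ^ a := by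
  obtain ⟨a, ha⟩ := IsPGroup.iff_card.1 hS.isPGroup
  refine ⟨a, Nat.one_le_iff_ne_zero.2 ?_, ha⟩
  rintro rfl
  obtain ⟨x, hx⟩ := exists_prime_orderOf_dvd_card' p hpG
  have h1 : x ∈ S := hS.mem_of_pow x 1 (by rw [pow_one, ← hx, pow_orderOf_eq_one])
  rw [pow_zero, Subgroup.card_eq_one] at ha
  rw [ha, Subgroup.mem_bot] at h1
  rw [h1, orderOf_one] at hx
  exact hp.out.one_lt.ne hx

theorem IsNormalSylowSelfCentralizing.not_dvd_index {S : Subgroup G}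
    (hS : IsNormalSylowSelfCentralizing p S) (hpG : p ∣ Nat.card G) : p.Coprime S.index := by
  obtain ⟨a, ha, hcard⟩ := hS.card_eq hpG
  exact hS.coprime_index.coprime_dvd_left (hcard ▸ dvd_pow_self p (by omega))

theorem IsNormalSylowSelfCentralizing.exists_complement {S : Subgroup G}
    (hS : IsNormalSylowSelfCentralizing p S) :
    ∃ H : Subgroup G, S.IsComplement' H ∧ Nat.card H = S.index := by
  have := hS.normal
  obtain ⟨H, hH⟩ := Subgroup.exists_right_complement'_of_coprime hS.coprime_index
  exact ⟨H, hH, hH.symm.index_eq_card.symm⟩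

/-- The quotient `G / S` has odd order and embeds in the automorphism group of a cyclic 2-group,
which is a 2-group. -/
theorem IsNormalSylowSelfCentralizing.eq_top_of_isCyclic {S : Subgroup G}
    (hS : IsNormalSylowSelfCentralizing 2 S) (h2 : 2 ∣ Nat.card G) (hc : IsCyclic S) : S = ⊤ := by
  have := hS.normal
  obtain ⟨a, ha, hcard⟩ := hS.card_eq h2
  have hker : (MulAut.conjNormal : G →* MulAut S).ker = S := by
    ext g
    rw [MonoidHom.mem_ker]
    constructor
    · intro h
      apply hS.centralizer_le
      intro s hs
      have h1 := congrArg Subtype.val (DFunLike.congr_fun h (⟨s, hs⟩ : S))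
      rw [MulAut.conjNormal_apply] at h1
      exact (mul_inv_eq_iff_eq_mul.1 h1).symm
    · intro hg
      ext s
      rw [MulAut.conjNormal_apply]
      have h1 : g * s.1 = s.1 * g :=
        congrArg Subtype.val ((IsCyclic.isMulCommutative (α := S)).is_comm.comm ⟨g, hg⟩ s)
      rw [h1, mul_inv_cancel_right]
      rfl
  have h1 : S.index ∣ 2 ^ (a - 1) := by
    have h3 : S.index = Nat.card (MulAut.conjNormal : G →* MulAut S).range := by
      conv_lhs => rw [← hker]
      exact Nat.card_congr (QuotientGroup.quotientKerEquivRange _).toEquiv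
    have h4 := Subgroup.card_subgroup_dvd_card (MulAut.conjNormal : G →* MulAut S).range
    rw [IsCyclic.card_mulAut, hcard, Nat.totient_prime_pow Nat.prime_two (by omega),
      show 2 - 1 = 1 from rfl, mul_one] at h4
    rwa [h3]
  rw [← Subgroup.index_eq_one]
  exact Nat.Coprime.eq_one_of_dvd ((hS.not_dvd_index h2).symm.pow_right _) h1

/-- If `S` is elementary abelian, an element of a complement centralizing the complement and
fixing an involution of `S` is trivial. -/
theorem IsApiAt.eq_one_of_fixes {S H : Subgroup G} (hG : IsApiAt 2 G)
    (hS : IsNormalSylowSelfCentralizing 2 S) (hcomm : ∀ x ∈ S, ∀ y ∈ S, x * y = y * x)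
    (hexp : ∀ x ∈ S, x ^ 2 = 1) (hSH : S.IsComplement' H) {h s : G} (hh : h ∈ H)
    (hH : ∀ k ∈ H, k * h = h * k) (hs : s ∈ S) (hs1 : s ≠ 1) (hfix : h * s = s * h) : h = 1 := by
  refine Subgroup.disjoint_def.1 hSH.disjoint (hS.centralizer_le ?_) hh
  intro t ht
  by_cases ht1 : t = 1
  · rw [ht1, one_mul, mul_one]
  have hso : orderOf s = 2 ^ 1 := (orderOf_eq_prime (hexp s hs) hs1).trans (pow_one 2).symm
  have hto : orderOf t = 2 ^ 1 := (orderOf_eq_prime (hexp t ht) ht1).trans (pow_one 2).symm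
  obtain ⟨g, hg⟩ := hG 1 (Subgroup.zpowers s) (Subgroup.zpowers t) inferInstance inferInstance
    (by rw [Nat.card_zpowers, hso]) (by rw [Nat.card_zpowers, hto])
  have hgs : g * s * g⁻¹ = t := by
    have h1 : g * s * g⁻¹ ∈ Subgroup.zpowers t := hg ▸ ⟨s, Subgroup.mem_zpowers s, rfl⟩
    obtain ⟨i, hi⟩ := h1
    simp only at hi
    rcases Int.even_or_odd' i with ⟨c, rfl | rfl⟩
    · rw [zpow_mul, zpow_ofNat, hexp t ht, one_zpow] at hi
      exact absurd (conj_eq_one_iff.1 hi.symm) hs1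
    · rw [zpow_add, zpow_mul, zpow_ofNat, hexp t ht, one_zpow, one_mul, zpow_one] at hi
      exact hi.symm
  -- The factor `b` acts trivially on the abelian group `S`, so `k ∈ H` already carries `s` to `t`;
  -- since `h` commutes with `k`, it fixes `t` as well.
  obtain ⟨⟨⟨b, hb⟩, ⟨k, hk⟩⟩, rfl⟩ := hSH.2 g
  simp only at hgs
  have hks : k * s * k⁻¹ = t := by
    have hmem : k * s * k⁻¹ ∈ S := hS.normal.conj_mem s hs k
    have h2 : b * (k * s * k⁻¹) * b⁻¹ = t := by
      rw [← hgs]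
      group
    rwa [hcomm b hb _ hmem, mul_inv_cancel_right] at h2
  have h3 : h * k⁻¹ = k⁻¹ * h := by
    rw [eq_inv_mul_iff_mul_eq, ← mul_assoc, hH k hk, mul_inv_cancel_right]
  rw [← hks]
  calc k * s * k⁻¹ * h = k * s * (h * k⁻¹) := by rw [h3, mul_assoc]
    _ = k * (h * s) * k⁻¹ := by rw [hfix]; group
    _ = h * (k * s * k⁻¹) := by rw [← mul_assoc k, hH k hk]; group

/-- The fixed points on `S` of an element of order `r` number `|S|` modulo `r`, so some nontrivial
one exists; a central element of the complement with such a fixed point is trivial. -/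
theorem IsApiAt.orderOf_ne_of_mem_center {S H : Subgroup G} (hG : IsApiAt 2 G)
    (hS : IsNormalSylowSelfCentralizing 2 S) (hcomm : ∀ x ∈ S, ∀ y ∈ S, x * y = y * x)
    (hexp : ∀ x ∈ S, x ^ 2 = 1) (hSH : S.IsComplement' H) {r : ℕ} (hr : r.Prime)
    (hmod : ¬ Nat.card S ≡ 1 [MOD r]) (h : H) (hh : h ∈ Subgroup.center H) : orderOf h ≠ r := by
  intro hho
  have := hS.normal
  have : Fact r.Prime := ⟨hr⟩
  have hpg : IsPGroup r (Subgroup.zpowers h.1) := IsPGroup.of_card (n := 1) (by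
    rw [Nat.card_zpowers, Subgroup.orderOf_coe, hho, pow_one])
  let _ : MulAction (Subgroup.zpowers h.1) S :=
    MulAction.compHom S ((MulAut.conjNormal : G →* MulAut S).comp (Subgroup.zpowers h.1).subtype)
  have hfix : ∃ s ∈ S, s ≠ 1 ∧ h.1 * s = s * h.1 := by
    by_contra! hno
    apply hmod
    refine (hpg.card_modEq_card_fixedPoints S).trans ?_
    have : MulAction.fixedPoints (Subgroup.zpowers h.1) S = {1} := by
      ext s
      rw [Set.mem_singleton_iff]
      constructor
      · intro hs
        by_contra hs1
        apply hno s.1 s.2 (fun hc => hs1 (Subtype.ext hc))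
        have h1 := congrArg Subtype.val (hs ⟨h.1, Subgroup.mem_zpowers _⟩)
        change h.1 * s.1 * h.1⁻¹ = s.1 at h1
        exact mul_inv_eq_iff_eq_mul.1 h1
      · rintro rfl g
        exact map_one (MulAut.conjNormal g.1 : MulAut S)
    rw [this, Nat.card_unique]
  obtain ⟨s, hs, hs1, hsfix⟩ := hfix
  have h1 := hG.eq_one_of_fixes hS hcomm hexp hSH h.2
    (fun k hk => congrArg Subtype.val (Subgroup.mem_center_iff.1 hh ⟨k, hk⟩)) hs hs1 hsfix
  have h2 : h = 1 := Subtype.ext h1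
  rw [h2, orderOf_one] at hho
  exact hr.one_lt.ne hho

theorem IsApiAt.isFaithfulSemidirect_elemAbGrp {S : Subgroup G} {n : ℕ}
    (hS : IsNormalSylowSelfCentralizing 2 S) (e : S ≃* ElemAbGrp 2 n) {q : ℕ} (hq : q.Prime)
    (hindex : S.index = q) : IsFaithfulSemidirect G (ElemAbGrp 2 n) (CyclicGrp q) := by
  have : Fact q.Prime := ⟨hq⟩
  obtain ⟨H, hSH, hH⟩ := hS.exists_complement
  exact isFaithfulSemidirect_of_isComplement' hS.normal hSH hS.centralizer_le e
    (mulEquivOfPrimeCardEq (hH.trans hindex) (card_cyclicGrp q))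

theorem IsApiAt.isFaithfulDoubleSemidirect_elemAbGrp {S : Subgroup G} {n : ℕ} (hG : IsApiAt 2 G)
    (hS : IsNormalSylowSelfCentralizing 2 S) (hcomm : ∀ x ∈ S, ∀ y ∈ S, x * y = y * x)
    (hexp : ∀ x ∈ S, x ^ 2 = 1) (e : S ≃* ElemAbGrp 2 n) {q r : ℕ} (hq : q.Prime) (hr : r.Prime)
    (hrq : r < q) (hindex : S.index = q * r) (hmod : ¬ 2 ^ n ≡ 1 [MOD r]) :
    IsFaithfulDoubleSemidirect G (ElemAbGrp 2 n) (CyclicGrp q) (CyclicGrp r) := by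
  obtain ⟨H, hSH, hH⟩ := hS.exists_complement
  have hcard : Nat.card S = 2 ^ n := by
    rw [Nat.card_congr e.toEquiv]
    change Nat.card (Fin n → ZMod 2) = 2 ^ n
    rw [Nat.card_fun, Nat.card_zmod, Nat.card_fin]
  obtain ⟨ψ, hψ, ⟨f⟩⟩ := isFaithfulSemidirect_of_card_eq_mul hq hr hrq (hH.trans hindex)
    (hG.orderOf_ne_of_mem_center hS hcomm hexp hSH hr (hcard ▸ hmod))
  exact ⟨ψ, hψ, isFaithfulSemidirect_of_isComplement' hS.normal hSH hS.centralizer_le e f⟩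

/-- In the quaternion group a cyclic subgroup of order 4 is normal, so it is not conjugate to the
others. -/
theorem IsApiAt.ne_top_of_quaternion {S : Subgroup G} (hG : IsApiAt 2 G)
    (e : S ≃* QuaternionGroup 2) : S ≠ ⊤ := by
  rintro rfl
  let f : G ≃* QuaternionGroup 2 := Subgroup.topEquiv.symm.trans e
  set x := f.symm (QuaternionGroup.a 1) with hx
  set y := f.symm (QuaternionGroup.xa 0) with hy
  have hxo : orderOf x = 2 ^ 2 :=
    (f.symm.orderOf_eq _).trans QuaternionGroup.orderOf_a_one
  have hyo : orderOf y = 2 ^ 2 :=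
    (f.symm.orderOf_eq _).trans (QuaternionGroup.orderOf_xa 0)
  have hconj : ∀ u : QuaternionGroup 2, u * .a 1 * u⁻¹ = .a 1 ∨ u * .a 1 * u⁻¹ = (.a 1) ^ 3 := by
    decide
  have hN : (Subgroup.zpowers x).Normal := by
    refine ⟨?_⟩
    rintro _ ⟨i, rfl⟩ g
    simp only
    rw [← conj_zpow]
    apply Subgroup.zpow_mem
    have h1 : g * x * g⁻¹ = f.symm (f g * .a 1 * (f g)⁻¹) := by simp [hx]
    rw [h1]
    rcases hconj (f g) with h | h
    · rw [h]
      exact Subgroup.mem_zpowers x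
    · rw [h, map_pow]
      exact Subgroup.npow_mem_zpowers x 3
  obtain ⟨i, hi⟩ := hG.mem_normal_of_orderOf_eq hN hxo hyo (Subgroup.mem_zpowers x)
  have hxy : x * y = y * x := by
    rw [← hi]
    exact (Commute.refl x).zpow_right i
  rw [hx, hy, ← map_mul, ← map_mul] at hxy
  exact absurd (f.symm.injective hxy) (by decide)

theorem IsApiAt.isFaithfulSemidirect_quatGrp {S : Subgroup G} (hG : IsApiAt 2 G)
    (h2 : 2 ∣ Nat.card G) (hS : IsNormalSylowSelfCentralizing 2 S)
    (e : S ≃* QuaternionGroup 2) : IsFaithfulSemidirect G QuatGrp (CyclicGrp 3) := by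
  have : Fact (Nat.Prime 3) := ⟨Nat.prime_three⟩
  obtain ⟨H, hSH, hH⟩ := hS.exists_complement
  obtain ⟨φ, hφ, -⟩ := isFaithfulSemidirect_of_isComplement' hS.normal hSH hS.centralizer_le e
    (MulEquiv.refl H)
  have h3 : Nat.card H ∣ 3 := card_dvd_three_of_odd φ hφ
    (hH ▸ Nat.coprime_two_left.1 (hS.not_dvd_index h2))
  have hcard : Nat.card H = 3 := by
    refine ((Nat.dvd_prime Nat.prime_three).1 h3).resolve_left fun h1 => ?_
    exact hG.ne_top_of_quaternion e (Subgroup.index_eq_one.1 (hH.symm.trans h1))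
  exact isFaithfulSemidirect_of_isComplement' hS.normal hSH hS.centralizer_le e
    (mulEquivOfPrimeCardEq hcard (card_cyclicGrp 3))

theorem nonempty_mulEquiv_cyclicGrp {S : Type*} [Group S] [IsCyclic S] {n : ℕ}
    (h : Nat.card S = n) : Nonempty (S ≃* CyclicGrp n) :=
  ⟨mulEquivOfCyclicCardEq (h.trans (card_cyclicGrp n).symm)⟩

theorem IsApiAt.sylow_structure (hG : IsApiAt p G) (hs : Group.IsSolvable G)
    (hcore : ∀ M : Subgroup G, M.Normal → (Nat.card M).Coprime p → M = ⊥)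
    (hpG : p ∣ Nat.card G) (Q : Sylow p G) :
    (∃ a : ℕ, 1 ≤ a ∧ Nonempty (Q ≃* CyclicGrp (p ^ a))) ∨
      (∃ n : ℕ, Nonempty (Q ≃* ElemAbGrp p n) ∧ (n = 2 ∨ n = 3 ∨ (n = 5 ∧ p = 2))) ∨
      (p = 2 ∧ Nonempty (Q ≃* QuatGrp)) := by
  obtain ⟨S, hS, h⟩ := hG.exists_normal_sylow hs hcore hpG
  obtain rfl := hS.eq_sylow Q
  by_cases hc : IsCyclic Q
  · obtain ⟨a, ha, hcard⟩ := hS.card_eq hpG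
    exact Or.inl ⟨a, ha, nonempty_mulEquiv_cyclicGrp hcard⟩
  · rcases h with h | h | ⟨hcomm, hexp⟩
    · exact absurd h hc
    · exact Or.inr (Or.inr h)
    · obtain ⟨n, hn, hn', -⟩ := hG.elementary_structure hs hS hcomm hexp hc
      exact Or.inr (Or.inl ⟨n, hn, hn'⟩)

theorem IsApiAt.structure_of_oddCore_eq_bot (hG : IsApiAt 2 G) (hs : Group.IsSolvable G)
    (hcore : ∀ M : Subgroup G, M.Normal → (Nat.card M).Coprime 2 → M = ⊥) :
    (∃ a : ℕ, Nonempty (G ≃* CyclicGrp (2 ^ a))) ∨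
      IsFaithfulSemidirect G (ElemAbGrp 2 2) (CyclicGrp 3) ∨
      IsFaithfulDoubleSemidirect G (ElemAbGrp 2 3) (CyclicGrp 7) (CyclicGrp 3) ∨
      IsFaithfulSemidirect G (ElemAbGrp 2 3) (CyclicGrp 7) ∨
      IsFaithfulDoubleSemidirect G (ElemAbGrp 2 5) (CyclicGrp 31) (CyclicGrp 5) ∨
      IsFaithfulSemidirect G QuatGrp (CyclicGrp 3) := by
  by_cases h2 : 2 ∣ Nat.card G
  swap
  · have h1 := hcore ⊤ inferInstance (by
      rw [Subgroup.card_top]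
      exact ((Nat.Prime.coprime_iff_not_dvd Nat.prime_two).2 h2).symm)
    have h3 : Nat.card G = 2 ^ 0 := by
      rw [← Subgroup.card_top, h1, Subgroup.card_bot, pow_zero]
    have := (Nat.card_eq_one_iff_unique.1 h3).1
    exact Or.inl ⟨0, nonempty_mulEquiv_cyclicGrp h3⟩
  obtain ⟨S, hS, h⟩ := hG.exists_normal_sylow hs hcore h2
  by_cases hc : IsCyclic S
  · obtain rfl := hS.eq_top_of_isCyclic h2 hc
    obtain ⟨a, -, hcard⟩ := hS.card_eq h2
    obtain ⟨e⟩ := nonempty_mulEquiv_cyclicGrp hcard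
    exact Or.inl ⟨a, ⟨Subgroup.topEquiv.symm.trans e⟩⟩
  rcases h with h | ⟨-, ⟨e⟩⟩ | ⟨hcomm, hexp⟩
  · exact absurd h hc
  · exact Or.inr (Or.inr (Or.inr (Or.inr (Or.inr (hG.isFaithfulSemidirect_quatGrp h2 hS e)))))
  · have hodd := hS.not_dvd_index h2
    obtain ⟨n, ⟨e⟩, rfl | rfl | ⟨rfl, -⟩, hn⟩ := hG.elementary_structure hs hS hcomm hexp hc
    · obtain ⟨h3, h4, -⟩ := hn rfl
      -- The index is odd, divides 6 and is a multiple of 3.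
      have h5 : S.index = 3 := Nat.dvd_antisymm (hodd.symm.dvd_of_dvd_mul_left h3) h4
      exact Or.inr (Or.inl (isFaithfulSemidirect_elemAbGrp hS e Nat.prime_three h5))
    · obtain ⟨h3, ⟨k, hk⟩, -⟩ := hn rfl
      norm_num at hk h3
      have h5 : k ∣ 3 := Nat.dvd_of_mul_dvd_mul_left (k := 7) (by norm_num) (hk ▸ h3)
      rcases (Nat.dvd_prime Nat.prime_three).1 h5 with rfl | rfl
      · exact Or.inr (Or.inr (Or.inr (Or.inl
          (isFaithfulSemidirect_elemAbGrp hS e (by norm_num) hk))))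
      · exact Or.inr (Or.inr (Or.inl (hG.isFaithfulDoubleSemidirect_elemAbGrp hS hcomm hexp e
          (by norm_num) (by norm_num) (by norm_num) hk (by decide))))
    · obtain ⟨h3, -, h4⟩ := hn rfl
      have h5 : S.index = 31 * 5 := Nat.dvd_antisymm h3 (h4 rfl)
      exact Or.inr (Or.inr (Or.inr (Or.inr (Or.inl
        (hG.isFaithfulDoubleSemidirect_elemAbGrp hS hcomm hexp e (by norm_num) (by norm_num)
          (by norm_num) h5 (by decide))))))

end Structure

/-! ### The classification -/

theorem theorem12 (X : Type*) [Group X] [Finite X] (hsolv : Group.IsSolvable X) (hX : IsApiGroup X) :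
    (∀ p : ℕ, p.Prime → p ∣ Nat.card X → ∀ S : Sylow p X,
      (∃ a : ℕ, 1 ≤ a ∧ Nonempty (S ≃* CyclicGrp (p ^ a))) ∨
      (p ≠ 2 ∧ Nonempty (S ≃* ElemAbGrp p 2)) ∨
      (p ≠ 2 ∧ Nonempty (S ≃* ElemAbGrp p 3)) ∨
      (p = 2 ∧ Nonempty (S ≃* ElemAbGrp 2 2)) ∨
      (p = 2 ∧ Nonempty (S ≃* ElemAbGrp 2 3)) ∨
      (p = 2 ∧ Nonempty (S ≃* ElemAbGrp 2 5)) ∨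
      (p = 2 ∧ Nonempty (S ≃* QuatGrp))) ∧
    ((∃ a : ℕ, Nonempty (X ⧸ oddCore X ≃* CyclicGrp (2 ^ a))) ∨
      IsFaithfulSemidirect (X ⧸ oddCore X) (ElemAbGrp 2 2) (CyclicGrp 3) ∨
      IsFaithfulDoubleSemidirect (X ⧸ oddCore X) (ElemAbGrp 2 3) (CyclicGrp 7) (CyclicGrp 3) ∨
      IsFaithfulSemidirect (X ⧸ oddCore X) (ElemAbGrp 2 3) (CyclicGrp 7) ∨
      IsFaithfulDoubleSemidirect (X ⧸ oddCore X) (ElemAbGrp 2 5) (CyclicGrp 31) (CyclicGrp 5) ∨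
      IsFaithfulSemidirect (X ⧸ oddCore X) QuatGrp (CyclicGrp 3)) := by
  have hapi : ∀ p : ℕ, p.Prime → IsApiAt p X := fun p hp n A B => hX p n hp A B
  refine ⟨fun p hp hpX S => ?_, ?_⟩
  · have : Fact p.Prime := ⟨hp⟩
    obtain ⟨N, hN, hNp, hmax⟩ := exists_primeToPCore X p
    have hpG : p ∣ Nat.card (X ⧸ N) := by
      refine Nat.Coprime.dvd_of_dvd_mul_right hNp.symm ?_
      rwa [← Subgroup.card_eq_card_quotient_mul_card_subgroup]
    let T : Sylow p (X ⧸ N) := S.mapSurjective (QuotientGroup.mk'_surjective N)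
    let e : S ≃* T := equivMapOfIsPGroup hNp S.2
    rcases ((hapi p hp).quotient hNp).sylow_structure inferInstance
      (eq_bot_of_normal_quotient hNp hmax) hpG T with
      ⟨a, ha, ⟨f⟩⟩ | ⟨n, ⟨f⟩, hn⟩ | ⟨rfl, ⟨f⟩⟩
    · exact Or.inl ⟨a, ha, ⟨e.trans f⟩⟩
    · have he := e.trans f
      by_cases h2 : p = 2
      · subst h2
        rcases hn with rfl | rfl | ⟨rfl, -⟩
        · exact Or.inr (Or.inr (Or.inr (Or.inl ⟨rfl, ⟨he⟩⟩)))
        · exact Or.inr (Or.inr (Or.inr (Or.inr (Or.inl ⟨rfl, ⟨he⟩⟩))))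
        · exact Or.inr (Or.inr (Or.inr (Or.inr (Or.inr (Or.inl ⟨rfl, ⟨he⟩⟩)))))
      · rcases hn with rfl | rfl | ⟨-, h⟩
        · exact Or.inr (Or.inl ⟨h2, ⟨he⟩⟩)
        · exact Or.inr (Or.inr (Or.inl ⟨h2, ⟨he⟩⟩))
        · exact absurd h h2
    · exact Or.inr (Or.inr (Or.inr (Or.inr (Or.inr (Or.inr ⟨rfl, ⟨e.trans f⟩⟩)))))
  · obtain ⟨hN2, hmax⟩ := oddCore_primeToTwo X
    exact ((hapi 2 Nat.prime_two).quotient hN2).structure_of_oddCore_eq_bot inferInstance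
      (eq_bot_of_normal_quotient hN2 hmax)
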